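/- **Setting.** Let $X\subset\mathbb{N}$ have at least two elements, $\hat\Sigma=X^{\mathbb{Z}}$ with the distance $\sum_{k\in\mathbb Z}2^{-|k|}[x_k\neq y_k]$ and the shift $\hat\sigma$; write $\Sigma^-=X^{\mathbb{Z}_{<0}}$, $\Sigma=X^{\mathbb{Z}_{\ge 0}}$, $\hat\Sigma=\Sigma^-\times\Sigma$, and $P:\hat\Sigma\to\Sigma$ for the projection. Let $K$ be a compact (connected) Riemannian manifold, $\hat M=\hat\Sigma\times K$, $M=\Sigma\times K$. Let $\hat f(\hat x,t)=(\hat\sigma(\hat x),\hat f_{\hat x}(t))$ be a homeomorphism of $\hat M$ such that the $\hat f_{\hat x}$ are $C^1$ diffeomorphisms of $K$ with $\tfrac12\|D\hat f_{\hat x}(t)\|<1$ and $\tfrac12\|D\hat f_{\hat x}^{-1}(t)\|<1$ everywhere, $\hat x\mapsto\hat f_{\hat x}$ is Hölder continuous in the $C^1$ distance, and $\sup_{\hat x\in\hat\Sigma,\,n\in\mathbb{Z}}\|D\hat f^n_{\hat x}\|<\infty$ (mostly neutral center direction). If $\hat x,\hat y$ have the same entries in all positions $k\le 0$, let $h^u_{\hat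 x,\hat y}=\lim_{n\to-\infty}(\hat f^n_{\hat y})^{-1}\circ\hat f^n_{\hat x}$, and let $W^{uu}_{loc}(\hat x,t)$ be the set of all the points $(\hat y,h^u_{\hat x,\hat y}(t))$. Let $\hat\mu=\hat\rho\,(\mu^s\times\mu^u\times\mu^c)$ be an $\hat f$-invariant probability measure on $\hat M$, where $\mu^s,\mu^u,\mu^c$ are probability measures on $\Sigma^-,\Sigma,K$, the supports of $\mu^s$ and $\mu^u$ are all of $\Sigma^-$ and $\Sigma$, and $\hat\rho$ is continuous and bounded from zero and infinity. Put $\rho(x,t)=\int\hat\rho(x^s,x,t)\,d\mu^s(x^s)$. Let $1\le l<d$ and let $\hat A:\hat M\to GL(d,\mathbb{C})$ be $\alpha$-Hölder continuous, $\alpha>0$, and admit strong-unstable holonomies: linear isomorphisms $H^u_{\hat p,\hat q}$ of $\mathbb{C}^d$, for $\hat q\in W^{uu}_{loc}(\hat p)$, with $H^u_{\hat f^{-1}(\hat p),\hat f^{-1}(\hat q)}=\hat A(\hat f^{-1}(\hat q))^{-1}H^u_{\hat p,\hat q}\hat A(\hat f^{-1}(\hat p))$, $H^u_{\hat p,\hat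 p}=\mathrm{id}$, $H^u_{\hat p,\hat q}=H^u_{\hat z,\hat q}H^u_{\hat p,\hat z}$ for $\hat z \in W^{uu}_{loc}(\hat p)$, and $\|H^u_{\hat p,\hat q}-\mathrm{id}\|\le L\,\mathrm{dist}(\hat p,\hat q)^\alpha$ for some constant $L>0$. Assume that $\hat f_{\hat x}=f_x$ and $\hat A(\hat x,t)$ depend on $\hat x$ only through $x=P(\hat x)$, and write $f^j_x=f_{\sigma^{j-1}(x)}\circ\cdots\circ f_x$ for $j\ge 0$, where $\sigma$ is the one-sided shift. Let $\hat m$ be a $u$-state on $\hat M\times\mathrm{Grass}(l,d)$ that projects to $\hat\mu$ and is invariant under $\hat F(\hat q,V)=(\hat f(\hat q),\hat A(\hat q)V)$: it has a disintegration $\{\hat m_{\hat q}\}$ along the fibers $\{\hat q\}\times\mathrm{Grass}(l,d)$ and there is a set $\tilde M\subset\hat M$ of full $\hat\mu$-measure with $\hat m_{\hat q}=(H^u_{\hat b,\hat q})_*\hat m_{\hat b}$ for all $\hat b,\hat q\in\tilde M$ with $\hat q\in W^{uu}_{loc}(\hat b)$. Let $\mu$ and $m$ be the projections of $\hat\mu$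 and $\hat m$ to $M$ and $M\times\mathrm{Grass}(l,d)$. **Proposition.** There is a disintegration $\{m_{x,t}:(x,t)\in M\}$ of $m$ along the fibers $\{(x,t)\}\times\mathrm{Grass}(l,d)$ (a measurable family of probability measures, defined for every $(x,t)$) such that: 1. $m_{x,t}=\frac{1}{\rho(x,t)}\int\hat\rho(x^s,x,t)\,\hat m_{x^s,x,t}\,d\mu^s(x^s)$ for $\mu^c$-almost every $t$, for every $x\in\Sigma$ such that $(x^s,x,t)\in\tilde M$ for $\mu^s\times\mu^c$-almost every $(x^s,t)$. 2. For every continuous $\varphi:\mathrm{Grass}(l,d)\to\mathbb{R}$, every sequence $x_n\to x$ in $\Sigma$ and all integers $j_n\ge0$ such that $(f^{j_n}_{x_n})_n$ converges uniformly to some $g:K\to K$, the functions $t\mapsto\int\varphi\,dm_{x_n,f^{j_n}_{x_n}(t)}$ and $t\mapsto\int\varphi\,dm_{x,g(t)}$ are in $L^1(\mu^c)$, and the former converge to the latter in $L^1(\mu^c)$. 3. Consequently, for every sequence $x_n\to x$ in $\Sigma$ there is a subsequence $(x_{n_k})_k$ with $m_{x_{n_k},t}\to m_{x,t}$ in the weak$^*$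 topology for $\mu^c$-almost every $t\in K$. -/

import Mathlib

open MeasureTheory ProbabilityTheory Filter Topology Bundle
open scoped Manifold ContDiff

noncomputable section

namespace UStates

/-! ### Shift spaces

`ℤ → X` is the two-sided full shift on the alphabet `X ⊆ ℕ` (product of discrete spaces).
The space of futures `(x_k)_{k ≥ 0}` is `ℕ → X`; the space of pasts `(x_k)_{k < 0}` is also coded
by `ℕ → X`, its `n`-th entry being the symbol at position `-(n+1)`. -/

/-- The `n`-th power of the two-sided shift, `n ∈ ℤ`. -/
def shiftBy {X : Set ℕ} (n : ℤ) (x : ℤ → X) : ℤ → X := fun k => x (k + n)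

/-- The projection from the two-sided shift space to the space of futures. -/
def future {X : Set ℕ} (x : ℤ → X) : ℕ → X := fun k => x (k : ℤ)

/-- The two-sided sequence with past `xs` and future `xu`. -/
def glue {X : Set ℕ} (xs xu : ℕ → X) : ℤ → X
  | Int.ofNat k => xu k
  | Int.negSucc k => xs k

open Classical in
/-- The distance `∑_{k ∈ ℤ} 2^{-|k|} [x_k ≠ y_k]` on the two-sided shift space. -/
def shiftDist {X : Set ℕ} (x y : ℤ → X) : ℝ :=
  ∑' k : ℤ, if x k = y k then 0 else (1 / 2 : ℝ) ^ k.natAbs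

/-- The distance on `(ℤ → X) × K`. -/
def totalDist {X : Set ℕ} {K : Type*} [MetricSpace K] (p q : (ℤ → X) × K) : ℝ :=
  shiftDist p.1 q.1 + dist p.2 q.2

/-! ### Partially hyperbolic skew-products -/

section SkewProducts

variable (X : Set ℕ) (n : ℕ) (K : Type*) [MetricSpace K]
  [ChartedSpace (EuclideanSpace ℝ (Fin n)) K] [IsManifold (𝓡 n) ∞ K]
  [RiemannianBundle (fun t : K => TangentSpace (𝓡 n) t)]

/-- A partially hyperbolic skew-product `(x, t) ↦ (σ x, f_x t)` over the two-sided shift, with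
fibre the Riemannian manifold `K` and fibre maps `f_x` that are (`C^1`) diffeomorphisms. -/
structure SkewProduct where
  /-- the fibre maps -/
  fib : (ℤ → X) → (K ≃ₘ^1⟮𝓡 n, 𝓡 n⟯ K)
  isHomeomorph :
    IsHomeomorph (fun p : (ℤ → X) × K => ((shiftBy 1 p.1, fib p.1 p.2) : (ℤ → X) × K))
  /-- domination of the fibre maps by the base dynamics, whose contraction rate is `1 / 2` -/
  dominated : ∀ (x : ℤ → X) (t : K),
    (1 / 2 : ℝ) * ‖mfderiv (𝓡 n) (𝓡 n) (fib x) t‖ < 1 ∧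
    (1 / 2 : ℝ) * ‖mfderiv (𝓡 n) (𝓡 n) (fib x).symm t‖ < 1
  /-- Hölder dependence of `f_x` on `x` in the `C^1` distance. The `C^0` part is measured by the
  distance of `K`, the part on first derivatives by testing against smooth functions on `K`
  (equivalently, against the coordinates of a smooth embedding of `K` in a Euclidean space). -/
  holder : ∃ α : ℝ, 0 < α ∧
    (∃ C : ℝ, ∀ (x y : ℤ → X) (t : K), dist (fib x t) (fib y t) ≤ C * shiftDist x y ^ α) ∧
    ∀ φ : K → ℝ, ContMDiff (𝓡 n) 𝓘(ℝ, ℝ) ∞ φ →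
      ∃ C : ℝ, ∀ (x y : ℤ → X) (t : K) (v : TangentSpace (𝓡 n) t),
        let w : ℝ := mfderiv (𝓡 n) 𝓘(ℝ, ℝ) (fun s : K => φ (fib x s) - φ (fib y s)) t v
        |w| ≤ C * shiftDist x y ^ α * ‖v‖

variable {X n K}

namespace SkewProduct

/-- The map `(x, t) ↦ (σ x, f_x t)`. -/
def map (F : SkewProduct X n K) (p : (ℤ → X) × K) : (ℤ → X) × K :=
  (shiftBy 1 p.1, F.fib p.1 p.2)

/-- `f_{σ^{m-1} x} ∘ ⋯ ∘ f_x`. -/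
def fwd (F : SkewProduct X n K) (x : ℤ → X) : ℕ → (K ≃ₘ^1⟮𝓡 n, 𝓡 n⟯ K)
  | 0 => Diffeomorph.refl (𝓡 n) K 1
  | m + 1 => (fwd F x m).trans (F.fib (shiftBy m x))

/-- The fibre iterates `f^m_x`, `m ∈ ℤ`; for `m < 0` this is
`f_{σ^m x}⁻¹ ∘ ⋯ ∘ f_{σ^{-1} x}⁻¹ = (f^{-m}_{σ^m x})⁻¹`. -/
def iter (F : SkewProduct X n K) (x : ℤ → X) : ℤ → (K ≃ₘ^1⟮𝓡 n, 𝓡 n⟯ K)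
  | Int.ofNat m => F.fwd x m
  | Int.negSucc m => (F.fwd (shiftBy (Int.negSucc m) x) (m + 1)).symm

/-- Mostly neutral center direction: all fibre iterates have uniformly bounded derivatives. -/
def MostlyNeutral (F : SkewProduct X n K) : Prop :=
  ∃ C : ℝ, ∀ (x : ℤ → X) (m : ℤ) (t : K), ‖mfderiv (𝓡 n) (𝓡 n) (F.iter x m) t‖ ≤ C

/-- `F.Wuu p q` says that `q` belongs to the local strong-unstable set of `p`: with `p = (x, t)`
and `q = (y, s)`, the sequences `x` and `y` have the same entries in all positions `k ≤ 0`, and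
`s = h^u_{x,y}(t) = lim_{m → -∞} (f^m_y)⁻¹ (f^m_x t)`. -/
def Wuu (F : SkewProduct X n K) (p q : (ℤ → X) × K) : Prop :=
  (∀ k : ℤ, k ≤ 0 → q.1 k = p.1 k) ∧
  Tendsto (fun m : ℕ => (F.iter q.1 (-(m : ℤ))).symm (F.iter p.1 (-(m : ℤ)) p.2)) atTop (𝓝 q.2)

end SkewProduct

end SkewProducts

/-- The fibre iterates `f^j_x = f_{σ^{j-1} x} ∘ ⋯ ∘ f_x`, `j ≥ 0`, of a skew-product over the
one-sided shift. -/
def oneSidedIter {X : Set ℕ} {K : Type*} (f : (ℕ → X) → K → K) (x : ℕ → X) : ℕ → K → K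
  | 0 => id
  | j + 1 => f (fun k => x (k + j)) ∘ oneSidedIter f x j

/-! ### Measures with partial product structure -/

/-- The data of a probability measure `ρ · (μs × μu × μc)` with partial product structure. -/
structure PartialProduct (X : Set ℕ) (K : Type*) [TopologicalSpace K] [MeasurableSpace K] where
  /-- probability on pasts -/
  μs : Measure (ℕ → X)
  /-- probability on futures -/
  μu : Measure (ℕ → X)
  /-- probability on the fibre -/
  μc : Measure K
  isProb_s : IsProbabilityMeasure μs
  isProb_u : IsProbabilityMeasure μu
  isProb_c : IsProbabilityMeasure μc
  /-- the support of `μs` is the whole space -/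
  openPos_s : μs.IsOpenPosMeasure
  /-- the support of `μu` is the whole space -/
  openPos_u : μu.IsOpenPosMeasure
  /-- the density -/
  ρ : (ℤ → X) × K → ℝ
  continuous_ρ : Continuous ρ
  bounded_ρ : ∃ a b : ℝ, 0 < a ∧ ∀ p, a ≤ ρ p ∧ ρ p ≤ b
  isProb : IsProbabilityMeasure
    ((((μs.prod μu).prod μc).map
      (fun p : ((ℕ → X) × (ℕ → X)) × K => ((glue p.1.1 p.1.2, p.2) : (ℤ → X) × K))).withDensity
        (fun p => ENNReal.ofReal (ρ p)))

namespace PartialProduct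

variable {X : Set ℕ} {K : Type*} [TopologicalSpace K] [MeasurableSpace K]

/-- The measure `ρ · (μs × μu × μc)` on `(ℤ → X) × K`. -/
def measure (μ : PartialProduct X K) : Measure ((ℤ → X) × K) :=
  (((μ.μs.prod μ.μu).prod μ.μc).map
    (fun p : ((ℕ → X) × (ℕ → X)) × K => ((glue p.1.1 p.1.2, p.2) : (ℤ → X) × K))).withDensity
      (fun p => ENNReal.ofReal (μ.ρ p))

instance (μ : PartialProduct X K) : IsProbabilityMeasure μ.measure := μ.isProb

/-- The density `(x, t) ↦ ∫ ρ(xs, x, t) dμs(xs)` of the projection to `(ℕ → X) × K`. -/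
def ρu (μ : PartialProduct X K) (x : ℕ → X) (t : K) : ℝ :=
  ∫ xs, μ.ρ (glue xs x, t) ∂μ.μs

end PartialProduct

/-! ### Grassmannians -/

/-- The Grassmannian of `l`-dimensional subspaces of `ℂ^d`. -/
def Grass (l d : ℕ) : Type :=
  {V : Submodule ℂ (EuclideanSpace ℂ (Fin d)) // Module.finrank ℂ V = l}

/-- The usual topology of the Grassmannian: `V` depends on its orthogonal projection. -/
instance (l d : ℕ) : TopologicalSpace (Grass l d) :=
  TopologicalSpace.induced
    (fun V : Grass l d =>
      (V.1.starProjection : EuclideanSpace ℂ (Fin d) →L[ℂ] EuclideanSpace ℂ (Fin d)))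
    inferInstance

instance (l d : ℕ) : MeasurableSpace (Grass l d) := borel _

instance (l d : ℕ) : BorelSpace (Grass l d) := ⟨rfl⟩

/-- The action of an invertible linear map on the Grassmannian. -/
def Grass.map {l d : ℕ} (B : EuclideanSpace ℂ (Fin d) ≃L[ℂ] EuclideanSpace ℂ (Fin d))
    (V : Grass l d) : Grass l d :=
  ⟨V.1.map (B.toLinearEquiv : EuclideanSpace ℂ (Fin d) →ₗ[ℂ] EuclideanSpace ℂ (Fin d)),
    (LinearEquiv.finrank_map_eq B.toLinearEquiv V.1).trans V.2⟩

/-! ### Linear cocycles, holonomies, `u`-states -/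

section Cocycles

variable {X : Set ℕ} {n : ℕ} {K : Type*} [MetricSpace K]
  [ChartedSpace (EuclideanSpace ℝ (Fin n)) K] [IsManifold (𝓡 n) ∞ K]
  [RiemannianBundle (fun t : K => TangentSpace (𝓡 n) t)] {d : ℕ}

/-- `α`-Hölder continuity of a map with values in `GL(d, ℂ)`. -/
def IsHolderCocycle (α : ℝ)
    (A : (ℤ → X) × K → (EuclideanSpace ℂ (Fin d) ≃L[ℂ] EuclideanSpace ℂ (Fin d))) : Prop :=
  ∃ C : ℝ, ∀ p q : (ℤ → X) × K,
    ‖(A p : EuclideanSpace ℂ (Fin d) →L[ℂ] EuclideanSpace ℂ (Fin d)) - A q‖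
      ≤ C * totalDist p q ^ α

/-- `H` is a family of strong-unstable holonomies of the cocycle `A` over `F`. Only the values
`H p q` with `q` in the local strong-unstable set of `p` are relevant. -/
structure IsUnstableHolonomy (F : SkewProduct X n K) (α : ℝ)
    (A : (ℤ → X) × K → (EuclideanSpace ℂ (Fin d) ≃L[ℂ] EuclideanSpace ℂ (Fin d)))
    (H : (ℤ → X) × K → (ℤ → X) × K →
      (EuclideanSpace ℂ (Fin d) ≃L[ℂ] EuclideanSpace ℂ (Fin d))) : Prop where
  /-- `H_{f⁻¹ p, f⁻¹ q} = A(f⁻¹ q)⁻¹ ∘ H_{p,q} ∘ A(f⁻¹ p)`, written with `f p`, `f q` for `p`, `q`;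
  the relation for higher backward iterates follows by iteration. -/
  equivariant : ∀ p q : (ℤ → X) × K, F.Wuu (F.map p) (F.map q) →
    ∀ v, H (F.map p) (F.map q) (A p v) = A q (H p q v)
  refl : ∀ p v, H p p v = v
  comp : ∀ p q z : (ℤ → X) × K, F.Wuu p q → F.Wuu p z → ∀ v, H p q v = H z q (H p z v)
  holder : ∃ L : ℝ, 0 < L ∧ ∀ p q : (ℤ → X) × K, F.Wuu p q →
    ‖(H p q : EuclideanSpace ℂ (Fin d) →L[ℂ] EuclideanSpace ℂ (Fin d)) -
        ContinuousLinearMap.id ℂ (EuclideanSpace ℂ (Fin d))‖ ≤ L * totalDist p q ^ α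

/-- The skew-product `(p, V) ↦ (f p, A(p) V)` induced on the Grassmannian bundle. -/
def grassMap {l : ℕ} (F : SkewProduct X n K)
    (A : (ℤ → X) × K → (EuclideanSpace ℂ (Fin d) ≃L[ℂ] EuclideanSpace ℂ (Fin d)))
    (z : ((ℤ → X) × K) × Grass l d) : ((ℤ → X) × K) × Grass l d :=
  (F.map z.1, Grass.map (A z.1) z.2)

/-- The probability measure `mhat` on the Grassmannian bundle is a `u`-state projecting to `μ`, and
this is exhibited by the disintegration `κ`, which is invariant under the unstable holonomies `H`
on the set `S` of full `μ`-measure. -/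
structure IsUState [MeasurableSpace K] {l : ℕ} (F : SkewProduct X n K)
    (H : (ℤ → X) × K → (ℤ → X) × K →
      (EuclideanSpace ℂ (Fin d) ≃L[ℂ] EuclideanSpace ℂ (Fin d)))
    (μ : Measure ((ℤ → X) × K)) (mhat : Measure (((ℤ → X) × K) × Grass l d))
    (κ : Kernel ((ℤ → X) × K) (Grass l d)) (S : Set ((ℤ → X) × K)) : Prop where
  markov : IsMarkovKernel κ
  disintegration : μ ⊗ₘ κ = mhat
  full : μ Sᶜ = 0
  invariant : ∀ b ∈ S, ∀ q ∈ S, F.Wuu b q → κ q = (κ b).map (Grass.map (H b q))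

end Cocycles

end UStates

end

/-!
The average `η (x, t)` of the fibre measures over the pasts, with respect to their conditional law
given `(x, t)`, is a disintegration of the projected measure, but it is significant only for the
futures `x` in the dense set `D` of those above which `S` has full measure. What makes it extend is
`L¹` continuity: if `x, y ∈ D` agree on many positions, the unstable holonomy from `(xs, x, t)` to
`(xs, y, hol t)` is uniformly close to the identity and carries one fibre measure to the other,
while `hol` distorts `μs × μc` by a bounded factor, because invariance of a measure with density
bounded from zero and infinity bounds the distortion of `μc` by every iterate, uniformly. So the
integrals of the fibre measures form a Cauchy family in `L¹` along `D`, and so do those of `η`. By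
compactness of the Grassmannian, the limits are again integrals of a kernel `m`, which agrees with
`η` above `D` and is `L¹` continuous everywhere. Precomposing with `f^j_x` costs one more bounded
distortion, and a diagonal subsequence over a dense sequence of test functions turns `L¹`
convergence into weak* convergence almost everywhere.
-/

namespace UStates

open scoped NNReal ENNReal BoundedContinuousFunction

section LpConvergence

variable {Ω ι E : Type*} [MeasurableSpace Ω] {μ : Measure Ω} [NormedAddCommGroup E]

theorem eLpNorm_sub_le_add_sub {p : ℝ≥0∞} [Fact (1 ≤ p)] {f g h : Ω → E}
    (hf : AEStronglyMeasurable f μ) (hg : AEStronglyMeasurable g μ)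
    (hh : AEStronglyMeasurable h μ) :
    eLpNorm (f - h) p μ ≤ eLpNorm (f - g) p μ + eLpNorm (g - h) p μ := by
  simpa only [sub_add_sub_cancel] using eLpNorm_add_le (hf.sub hg) (hg.sub hh) Fact.out

theorem exists_memLp_tendsto_eLpNorm_sub [CompleteSpace E] {p : ℝ≥0∞} [Fact (1 ≤ p)]
    {l : Filter ι} [l.NeBot] {u : ι → Ω → E} (hu : ∀ i, MemLp (u i) p μ)
    (h : ∀ ε > 0, ∃ v, MemLp v p μ ∧ ∀ᶠ i in l, eLpNorm (u i - v) p μ ≤ ε) :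
    ∃ v, MemLp v p μ ∧ Tendsto (fun i => eLpNorm (u i - v) p μ) l (𝓝 0) := by
  have hcauchy : Cauchy (l.map fun i => (hu i).toLp) := by
    refine EMetric.cauchy_iff.2 ⟨map_neBot.ne, fun ε hε => ?_⟩
    obtain ⟨δ, hδ, hδε⟩ := exists_between hε
    obtain ⟨v, hv, hclose⟩ := h (δ / 2) (ENNReal.half_pos hδ.ne')
    refine ⟨_, image_mem_map hclose, ?_⟩
    rintro _ ⟨i, hi, rfl⟩ _ ⟨j, hj, rfl⟩
    calc edist ((hu i).toLp _) ((hu j).toLp _)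
        ≤ edist ((hu i).toLp _) (hv.toLp v) + edist ((hu j).toLp _) (hv.toLp v) :=
          edist_triangle_right _ _ _
      _ ≤ δ / 2 + δ / 2 := by simp only [Lp.edist_toLp_toLp]; exact add_le_add hi hj
      _ < ε := by rwa [ENNReal.add_halves]
  obtain ⟨V, hV⟩ := CompleteSpace.complete hcauchy
  refine ⟨V, Lp.memLp V, ?_⟩
  have := (Lp.tendsto_Lp_iff_tendsto_eLpNorm' _ _).1 hV
  refine this.congr fun i => eLpNorm_congr_ae ?_
  exact (hu i).coeFn_toLp.sub EventuallyEq.rfl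

theorem tendsto_eLpNorm_one_sub_of_dominated {l : Filter ι} [l.IsCountablyGenerated]
    {u : ι → Ω → E} {v : Ω → E} {bound : Ω → ℝ} (hu : ∀ i, AEStronglyMeasurable (u i) μ)
    (hbound : Integrable bound μ) (hle : ∀ i, ∀ᵐ x ∂μ, ‖u i x‖ ≤ bound x)
    (hlim : ∀ᵐ x ∂μ, Tendsto (fun i => u i x) l (𝓝 (v x))) :
    Tendsto (fun i => eLpNorm (u i - v) 1 μ) l (𝓝 0) := by
  refine tendsto_of_seq_tendsto fun s hs => ?_
  simp only [eLpNorm_one_eq_lintegral_enorm, Pi.sub_apply, ← ofReal_norm]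
  exact tendsto_lintegral_norm_of_dominated_convergence (fun k => hu (s k))
    hbound.hasFiniteIntegral (fun k => hle (s k)) (hlim.mono fun x hx => hx.comp hs)

theorem tendsto_eLpNorm_one_smul_sub_smul [NormedSpace ℝ E] {l : Filter ι}
    [l.IsCountablyGenerated] {a : ι → Ω → ℝ} {a₀ : Ω → ℝ} {u : ι → Ω → E} {v : Ω → E} {c : ℝ}
    (ha : ∀ i, AEStronglyMeasurable (a i) μ) (ha₀ : AEStronglyMeasurable a₀ μ)
    (hac : ∀ i x, ‖a i x‖ ≤ c) (halim : ∀ x, Tendsto (fun i => a i x) l (𝓝 (a₀ x)))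
    (hu : ∀ i, AEStronglyMeasurable (u i) μ) (hv : MemLp v 1 μ)
    (hulim : Tendsto (fun i => eLpNorm (u i - v) 1 μ) l (𝓝 0)) :
    Tendsto (fun i => eLpNorm (a i • u i - a₀ • v) 1 μ) l (𝓝 0) := by
  have hmul : Tendsto (fun i => eLpNorm (a i • v - a₀ • v) 1 μ) l (𝓝 0) :=
    tendsto_eLpNorm_one_sub_of_dominated (bound := fun x => c * ‖v x‖) (fun i => (ha i).smul hv.1)
      ((memLp_one_iff_integrable.1 hv).norm.const_mul c)
      (fun i => ae_of_all _ fun x => by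
        rw [Pi.smul_apply', norm_smul]
        exact mul_le_mul_of_nonneg_right (hac i x) (norm_nonneg _))
      (ae_of_all _ fun x => (halim x).smul_const (v x))
  have hbound : Tendsto (fun i => ENNReal.ofReal c * eLpNorm (u i - v) 1 μ +
      eLpNorm (a i • v - a₀ • v) 1 μ) l (𝓝 0) := by
    simpa using (ENNReal.Tendsto.const_mul hulim (Or.inr ENNReal.ofReal_ne_top)).add hmul
  refine tendsto_of_tendsto_of_tendsto_of_le_of_le (g := fun _ => 0) tendsto_const_nhds hbound
    (fun _ => bot_le) fun i => ?_
  calc eLpNorm (a i • u i - a₀ • v) 1 μ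
      ≤ eLpNorm (a i • u i - a i • v) 1 μ + eLpNorm (a i • v - a₀ • v) 1 μ :=
        eLpNorm_sub_le_add_sub ((ha i).smul (hu i)) ((ha i).smul hv.1) (ha₀.smul hv.1)
    _ ≤ ENNReal.ofReal c * eLpNorm (u i - v) 1 μ + eLpNorm (a i • v - a₀ • v) 1 μ := by
        gcongr
        refine eLpNorm_le_mul_eLpNorm_of_ae_le_mul (ae_of_all _ fun x => ?_) 1
        rw [← smul_sub, Pi.smul_apply', norm_smul]
        exact mul_le_mul_of_nonneg_right (hac i x) (norm_nonneg _)

theorem ae_tendsto_of_tsum_eLpNorm_one_ne_top {v : ℕ → Ω → E} {v₀ : Ω → E}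
    (hv : ∀ k, AEStronglyMeasurable (v k) μ) (hv₀ : AEStronglyMeasurable v₀ μ)
    (h : ∑' k, eLpNorm (v k - v₀) 1 μ ≠ ⊤) :
    ∀ᵐ x ∂μ, Tendsto (fun k => v k x) atTop (𝓝 (v₀ x)) := by
  have hm : ∀ k, AEMeasurable (fun x => ‖(v k - v₀) x‖ₑ) μ := fun k => ((hv k).sub hv₀).enorm
  simp only [eLpNorm_one_eq_lintegral_enorm, ← lintegral_tsum hm] at h
  filter_upwards [ae_lt_top' (AEMeasurable.tsum hm) h] with x hx
  rw [tendsto_iff_edist_tendsto_0]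
  simpa only [edist_eq_enorm_sub, Pi.sub_apply] using
    ENNReal.tendsto_atTop_zero_of_tsum_ne_top hx.ne

theorem exists_strictMono_forall_ae_tendsto {v : ℕ → ℕ → Ω → E} {v₀ : ℕ → Ω → E}
    (hv : ∀ a k, AEStronglyMeasurable (v a k) μ) (hv₀ : ∀ a, AEStronglyMeasurable (v₀ a) μ)
    (h : ∀ a, Tendsto (fun k => eLpNorm (v a k - v₀ a) 1 μ) atTop (𝓝 0)) :
    ∃ i : ℕ → ℕ, StrictMono i ∧
      ∀ᵐ x ∂μ, ∀ a, Tendsto (fun k => v a (i k) x) atTop (𝓝 (v₀ a x)) := by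
  obtain ⟨i, hi, hle⟩ := extraction_forall_of_eventually'
    (P := fun k n => ∀ a ∈ Finset.range (k + 1), eLpNorm (v a n - v₀ a) 1 μ ≤ 2⁻¹ ^ k)
    fun k => eventually_atTop.1 ((Finset.eventually_all _).2 fun a _ =>
      (h a).eventually (ge_mem_nhds (ENNReal.pow_pos (by norm_num) k)))
  refine ⟨i, hi, ae_all_iff.2 fun a => ?_⟩
  have hsum : ∑' k, eLpNorm (v a (i (k + a)) - v₀ a) 1 μ ≠ ⊤ := by
    refine ne_top_of_le_ne_top (b := ∑' k : ℕ, 2⁻¹ ^ k) ?_ (ENNReal.tsum_le_tsum fun k => ?_)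
    · simp [ENNReal.tsum_geometric]
    · exact (hle (k + a) a (Finset.mem_range.2 (by lia))).trans
        (pow_le_pow_right_of_le_one' (by norm_num) (by lia))
  filter_upwards [ae_tendsto_of_tsum_eLpNorm_one_ne_top (fun k => hv a (i (k + a))) (hv₀ a) hsum]
    with x hx
  exact (tendsto_add_atTop_iff_nat a).1 hx

end LpConvergence

section BoundedJacobian

variable {Ω Z ι : Type*} [MeasurableSpace Ω] [MeasurableSpace Z] {μ : Measure Ω} {ν : Measure Z}
  {C : ℝ≥0}

theorem map_le_smul_of_measurePreserving {T : Ω → Ω} {ν : Measure Ω} {a b : ℝ≥0} (ha : 0 < a)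
    (hT : MeasurePreserving T μ μ) (hlower : a • ν ≤ μ) (hupper : μ ≤ b • ν) :
    ν.map T ≤ (a⁻¹ * b) • ν := by
  have hν : ν ≤ a⁻¹ • μ := by
    calc ν = a⁻¹ • a • ν := by rw [smul_smul, inv_mul_cancel₀ ha.ne', one_smul]
      _ ≤ a⁻¹ • μ := by gcongr
  calc ν.map T ≤ (a⁻¹ • μ).map T := Measure.map_mono hν hT.measurable
    _ = a⁻¹ • μ := by rw [Measure.map_smul, hT.map_eq]
    _ ≤ (a⁻¹ * b) • ν := by rw [mul_smul]; gcongr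

theorem lintegral_comp_le_of_map_le {p : Ω → Z} (hp : Measurable p) (hle : μ.map p ≤ C • ν)
    {g : Z → ℝ≥0∞} (hg : Measurable g) : ∫⁻ x, g (p x) ∂μ ≤ C * ∫⁻ z, g z ∂ν := by
  rw [← lintegral_map hg hp]
  exact (lintegral_mono' hle le_rfl).trans_eq (lintegral_smul_measure ..)

theorem le_smul_of_forall_lintegral_le [TopologicalSpace Z]
    [TopologicalSpace.PseudoMetrizableSpace Z] [BorelSpace Z] {μ : Measure Z} [IsFiniteMeasure μ]
    [IsFiniteMeasure ν]
    (h : ∀ g : BoundedContinuousFunction Z ℝ≥0, ∫⁻ z, g z ∂μ ≤ C * ∫⁻ z, g z ∂ν) :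
    μ ≤ C • ν := by
  have hclosed : ∀ s, IsClosed s → μ s ≤ (C • ν) s := fun s hs =>
    le_of_tendsto_of_tendsto' (HasOuterApproxClosed.tendsto_lintegral_apprSeq hs μ)
      (ENNReal.Tendsto.const_mul (HasOuterApproxClosed.tendsto_lintegral_apprSeq hs ν)
        (Or.inr ENNReal.coe_ne_top)) fun n => h _
  refine Measure.le_iff.2 fun s hs => ?_
  rw [hs.measure_eq_iSup_isClosed_of_ne_top (measure_ne_top μ s)]
  exact iSup₂_le fun t hts => iSup_le fun ht => (hclosed t ht).trans (measure_mono hts)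

section Limits

variable [TopologicalSpace Z] [BorelSpace Z] {l : Filter ι} [l.IsCountablyGenerated]
  [IsFiniteMeasure μ] {p : ι → Ω → Z} {q : Ω → Z}

theorem tendsto_lintegral_boundedContinuous_comp (hp : ∀ i, Measurable (p i))
    (hlim : ∀ x, Tendsto (fun i => p i x) l (𝓝 (q x))) (g : BoundedContinuousFunction Z ℝ≥0) :
    Tendsto (fun i => ∫⁻ x, g (p i x) ∂μ) l (𝓝 (∫⁻ x, g (q x) ∂μ)) := by
  refine tendsto_lintegral_filter_of_dominated_convergence (fun _ => (nndist g 0 : ℝ≥0∞))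
    (Eventually.of_forall fun i =>
      g.continuous.measurable.coe_nnreal_ennreal.comp (hp i))
    (Eventually.of_forall fun i => ae_of_all _ fun x =>
      ENNReal.coe_le_coe.2 (nndist_comm 0 g ▸ g.apply_le_nndist_zero _)) ?_
    (ae_of_all _ fun x => ((ENNReal.continuous_coe.comp g.continuous).tendsto _).comp (hlim x))
  simp [lintegral_const, ENNReal.mul_eq_top]

theorem map_le_smul_of_tendsto [TopologicalSpace.PseudoMetrizableSpace Z] [IsFiniteMeasure ν]
    [l.NeBot] (hp : ∀ i, Measurable (p i)) (hle : ∀ i, μ.map (p i) ≤ C • ν)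
    (hlim : ∀ x, Tendsto (fun i => p i x) l (𝓝 (q x))) : μ.map q ≤ C • ν := by
  have hq : Measurable q := measurable_of_tendsto_metrizable' l hp (tendsto_pi_nhds.2 hlim)
  refine le_smul_of_forall_lintegral_le fun g => ?_
  have hg : Measurable fun z => (g z : ℝ≥0∞) := g.continuous.measurable.coe_nnreal_ennreal
  rw [lintegral_map hg hq]
  exact le_of_tendsto (tendsto_lintegral_boundedContinuous_comp hp hlim g)
    (Eventually.of_forall fun i => lintegral_comp_le_of_map_le (hp i) (hle i) hg)

end Limits

section Fibrewise

variable {K : Type*} [MeasurableSpace K] {h : Ω → K → K} {ν : Measure K}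

theorem map_prod_le_smul [SFinite ν] (hm : Measurable fun p : Ω × K => h p.1 p.2)
    (hle : ∀ x, ν.map (h x) ≤ C • ν) :
    (μ.prod ν).map (fun p => (p.1, h p.1 p.2)) ≤ C • μ.prod ν := by
  have hm' : Measurable fun p : Ω × K => (p.1, h p.1 p.2) := measurable_fst.prodMk hm
  refine Measure.le_iff.2 fun s hs => ?_
  rw [Measure.map_apply hm' hs, Measure.prod_apply (hm' hs), Measure.smul_apply,
    Measure.prod_apply hs, ENNReal.smul_def, smul_eq_mul,
    ← lintegral_const_mul _ (measurable_measure_prodMk_left hs)]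
  refine lintegral_mono fun x => ?_
  have hx : Measurable (h x) := hm.comp measurable_prodMk_left
  exact (Measure.map_apply hx (measurable_prodMk_left hs)).symm.trans_le (hle x (Prod.mk x ⁻¹' s))

theorem map_le_smul_of_map_prod_le_smul [TopologicalSpace Ω] [FirstCountableTopology Ω]
    [TopologicalSpace K] [TopologicalSpace.PseudoMetrizableSpace K]
    [BorelSpace K] [OpensMeasurableSpace (Ω × K)] [IsFiniteMeasure μ] [μ.IsOpenPosMeasure]
    [IsFiniteMeasure ν] (hcont : Continuous fun p : Ω × K => h p.1 p.2)
    (hle : (μ.prod ν).map (fun p => (p.1, h p.1 p.2)) ≤ C • μ.prod ν) (x : Ω) :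
    ν.map (h x) ≤ C • ν := by
  have hh : ∀ y, Measurable (h y) := fun y =>
    (hcont.comp (Continuous.prodMk_right y)).measurable
  refine le_smul_of_forall_lintegral_le fun g => ?_
  have hg : Measurable fun t => (g t : ℝ≥0∞) := g.continuous.measurable.coe_nnreal_ennreal
  have hgh : Measurable fun p : Ω × K => (g (h p.1 p.2) : ℝ≥0∞) := hg.comp hcont.measurable
  have hg_snd : Measurable fun p : Ω × K => (g p.2 : ℝ≥0∞) := hg.comp measurable_snd
  rw [lintegral_map hg (hh x)]
  have hA : Continuous fun y => ∫⁻ t, g (h y t) ∂ν := continuous_iff_continuousAt.2 fun y =>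
    tendsto_lintegral_boundedContinuous_comp hh
      (fun t => (hcont.comp (Continuous.prodMk_left t)).tendsto y) g
  have hae : ∀ᵐ y ∂μ, ∫⁻ t, g (h y t) ∂ν ≤ C * ∫⁻ t, g t ∂ν := by
    refine ae_le_of_forall_setLIntegral_le_of_sigmaFinite hgh.lintegral_prod_right'
      fun s hs _ => ?_
    have hle_s : ((μ.restrict s).prod ν).map (fun p => (p.1, h p.1 p.2)) ≤
        C • (μ.restrict s).prod ν := by
      have := Measure.restrict_mono_measure hle (s ×ˢ Set.univ)
      rwa [Measure.restrict_map (measurable_fst.prodMk hcont.measurable) (hs.prod .univ),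
        Set.mk_preimage_prod, Set.preimage_univ, Set.inter_univ, ← Set.prod_univ,
        Measure.restrict_smul, ← Measure.prod_restrict, Measure.restrict_univ] at this
    have := lintegral_comp_le_of_map_le (measurable_fst.prodMk hcont.measurable) hle_s hg_snd
    rwa [lintegral_prod _ hgh.aemeasurable, lintegral_prod _ hg_snd.aemeasurable,
      ← lintegral_const_mul _ hg_snd.lintegral_prod_right'] at this
  have hclosed : IsClosed {y | ∫⁻ t, g (h y t) ∂ν ≤ C * ∫⁻ t, g t ∂ν} :=
    isClosed_le hA continuous_const
  exact hclosed.closure_subset (Measure.dense_of_ae hae x)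

end Fibrewise

end BoundedJacobian

section CompositionContinuity

variable {Ω Z ι E : Type*} [MeasurableSpace Ω] [MeasurableSpace Z] {μ : Measure Ω} {ν : Measure Z}
  [NormedAddCommGroup E] {C : ℝ≥0}

theorem eLpNorm_one_comp_le_of_map_le {p : Ω → Z} (hp : Measurable p) (hle : μ.map p ≤ C • ν)
    {w : Z → E} (hw : AEStronglyMeasurable w ν) :
    eLpNorm (w ∘ p) 1 μ ≤ C * eLpNorm w 1 ν := by
  have hw' : AEStronglyMeasurable w (μ.map p) := (hw.smul_measure C).mono_measure hle
  rw [← eLpNorm_map_measure hw' hp.aemeasurable]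
  exact (eLpNorm_mono_measure w hle).trans_eq (eLpNorm_one_smul_measure _)

theorem aestronglyMeasurable_comp_of_map_le {p : Ω → Z} (hp : Measurable p)
    (hle : μ.map p ≤ C • ν) {w : Z → E} (hw : AEStronglyMeasurable w ν) :
    AEStronglyMeasurable (w ∘ p) μ :=
  ((hw.smul_measure C).mono_measure hle).comp_measurable hp

theorem memLp_one_comp_of_map_le {p : Ω → Z} (hp : Measurable p) (hle : μ.map p ≤ C • ν)
    {w : Z → E} (hw : MemLp w 1 ν) : MemLp (w ∘ p) 1 μ :=
  ⟨aestronglyMeasurable_comp_of_map_le hp hle hw.1,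
    (eLpNorm_one_comp_le_of_map_le hp hle hw.1).trans_lt
      (ENNReal.mul_lt_top ENNReal.coe_lt_top hw.2)⟩

variable [TopologicalSpace Z] [TopologicalSpace.PseudoMetrizableSpace Z] [BorelSpace Z]
  [IsFiniteMeasure μ] [IsFiniteMeasure ν] [NormedSpace ℝ E] {l : Filter ι} [l.NeBot]
  [l.IsCountablyGenerated] {p : ι → Ω → Z} {q : Ω → Z}

theorem tendsto_eLpNorm_one_comp_sub {w : Z → E} (hw : MemLp w 1 ν) (hp : ∀ i, Measurable (p i))
    (hle : ∀ i, μ.map (p i) ≤ C • ν) (hlim : ∀ x, Tendsto (fun i => p i x) l (𝓝 (q x))) :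
    Tendsto (fun i => eLpNorm (w ∘ p i - w ∘ q) 1 μ) l (𝓝 0) := by
  have hq : Measurable q := measurable_of_tendsto_metrizable' l hp (tendsto_pi_nhds.2 hlim)
  have hqle : μ.map q ≤ C • ν := map_le_smul_of_tendsto hp hle hlim
  refine ENNReal.tendsto_nhds_zero.2 fun ε hε => ?_
  have hε3 : 0 < ε / 3 := ENNReal.div_pos hε.ne' (by norm_num)
  obtain ⟨δ, hδ, hCδ⟩ := ENNReal.exists_pos_mul_lt (ENNReal.coe_ne_top (r := C)) hε3.ne'
  obtain ⟨φ, hφ, hφL⟩ := hw.exists_boundedContinuous_eLpNorm_sub_le ENNReal.one_ne_top hδ.ne'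
  obtain ⟨ψ, hψ⟩ : ∃ ψ : Z → E, ψ = φ := ⟨_, rfl⟩
  rw [← hψ] at hφ hφL
  have hψlim : Tendsto (fun i => eLpNorm (ψ ∘ p i - ψ ∘ q) 1 μ) l (𝓝 0) :=
    tendsto_eLpNorm_one_sub_of_dominated (bound := fun _ => ‖φ‖)
      (fun i => (memLp_one_comp_of_map_le (hp i) (hle i) hφL).1) (integrable_const _)
      (fun i => ae_of_all _ fun x => hψ ▸ φ.norm_coe_le_norm _)
      (ae_of_all _ fun x => ((hψ ▸ φ.continuous : Continuous ψ).tendsto _).comp (hlim x))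
  have happrox : ∀ r : Ω → Z, Measurable r → μ.map r ≤ C • ν →
      eLpNorm (w ∘ r - ψ ∘ r) 1 μ ≤ ε / 3 := fun r hr hrle =>
    calc eLpNorm ((w - ψ) ∘ r) 1 μ
        ≤ C * eLpNorm (w - ψ) 1 ν := eLpNorm_one_comp_le_of_map_le hr hrle (hw.sub hφL).1
      _ ≤ C * δ := by gcongr
      _ ≤ ε / 3 := by rw [mul_comm]; exact hCδ.le
  have hw_comp : ∀ r : Ω → Z, Measurable r → μ.map r ≤ C • ν →
      AEStronglyMeasurable (w ∘ r) μ := fun r hr hrle =>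
    aestronglyMeasurable_comp_of_map_le hr hrle hw.1
  have hψ_comp : ∀ r : Ω → Z, Measurable r → μ.map r ≤ C • ν →
      AEStronglyMeasurable (ψ ∘ r) μ := fun r hr hrle =>
    aestronglyMeasurable_comp_of_map_le hr hrle hφL.1
  filter_upwards [ENNReal.tendsto_nhds_zero.1 hψlim (ε / 3) hε3] with i hi
  calc eLpNorm (w ∘ p i - w ∘ q) 1 μ
      ≤ eLpNorm (w ∘ p i - ψ ∘ p i) 1 μ + (eLpNorm (ψ ∘ p i - ψ ∘ q) 1 μ +
          eLpNorm (ψ ∘ q - w ∘ q) 1 μ) :=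
        (eLpNorm_sub_le_add_sub (hw_comp _ (hp i) (hle i)) (hψ_comp _ (hp i) (hle i))
          (hw_comp _ hq hqle)).trans (add_le_add_right (eLpNorm_sub_le_add_sub
            (hψ_comp _ (hp i) (hle i)) (hψ_comp _ hq hqle) (hw_comp _ hq hqle)) _)
    _ ≤ ε / 3 + (ε / 3 + ε / 3) := by
        rw [eLpNorm_sub_comm (ψ ∘ q)]
        exact add_le_add (happrox _ (hp i) (hle i)) (add_le_add hi (happrox _ hq hqle))
    _ = ε := by rw [← add_assoc, ENNReal.add_thirds]

theorem exists_memLp_tendsto_eLpNorm_one_sub_of_comp [CompleteSpace E] {u : ι → Ω → E}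
    (hu : ∀ i, MemLp (u i) 1 μ)
    (h : ∀ ε > 0, ∃ (w : Z → E) (p : ι → Ω → Z) (q : Ω → Z), MemLp w 1 ν ∧
      (∀ i, Measurable (p i)) ∧ (∀ i, μ.map (p i) ≤ C • ν) ∧
      (∀ x, Tendsto (fun i => p i x) l (𝓝 (q x))) ∧
      ∀ᶠ i in l, eLpNorm (u i - w ∘ p i) 1 μ ≤ ε) :
    ∃ v, MemLp v 1 μ ∧ Tendsto (fun i => eLpNorm (u i - v) 1 μ) l (𝓝 0) := by
  refine exists_memLp_tendsto_eLpNorm_sub hu fun ε hε => ?_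
  have hε2 : 0 < ε / 2 := ENNReal.half_pos hε.ne'
  obtain ⟨w, p, q, hw, hp, hle, hlim, hclose⟩ := h (ε / 2) hε2
  have hwp : ∀ i, MemLp (w ∘ p i) 1 μ := fun i => memLp_one_comp_of_map_le (hp i) (hle i) hw
  have hwq : MemLp (w ∘ q) 1 μ := memLp_one_comp_of_map_le
    (measurable_of_tendsto_metrizable' l hp (tendsto_pi_nhds.2 hlim))
    (map_le_smul_of_tendsto hp hle hlim) hw
  refine ⟨w ∘ q, hwq, ?_⟩
  filter_upwards [hclose, (tendsto_eLpNorm_one_comp_sub hw hp hle hlim).eventually_le_const hε2]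
    with i hi hi'
  calc eLpNorm (u i - w ∘ q) 1 μ
      ≤ eLpNorm (u i - w ∘ p i) 1 μ + eLpNorm (w ∘ p i - w ∘ q) 1 μ :=
        eLpNorm_sub_le_add_sub (hu i).1 (hwp i).1 hwq.1
    _ ≤ ε / 2 + ε / 2 := add_le_add hi hi'
    _ = ε := ENNReal.add_halves ε

theorem tendsto_eLpNorm_one_comp_sub_comp {u : ι → Z → E} {w : Z → E}
    (hu : ∀ i, AEStronglyMeasurable (u i) ν) (hw : MemLp w 1 ν)
    (huw : Tendsto (fun i => eLpNorm (u i - w) 1 ν) l (𝓝 0)) (hp : ∀ i, Measurable (p i))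
    (hle : ∀ i, μ.map (p i) ≤ C • ν) (hlim : ∀ x, Tendsto (fun i => p i x) l (𝓝 (q x))) :
    Tendsto (fun i => eLpNorm (u i ∘ p i - w ∘ q) 1 μ) l (𝓝 0) := by
  have hq : Measurable q := measurable_of_tendsto_metrizable' l hp (tendsto_pi_nhds.2 hlim)
  have hbound : Tendsto (fun i => C * eLpNorm (u i - w) 1 ν + eLpNorm (w ∘ p i - w ∘ q) 1 μ) l
      (𝓝 0) := by
    simpa using (ENNReal.Tendsto.const_mul huw (Or.inr ENNReal.coe_ne_top)).add
      (tendsto_eLpNorm_one_comp_sub hw hp hle hlim)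
  refine tendsto_of_tendsto_of_tendsto_of_le_of_le (g := fun _ => 0) tendsto_const_nhds hbound
    (fun _ => bot_le) fun i => ?_
  calc eLpNorm (u i ∘ p i - w ∘ q) 1 μ
      ≤ eLpNorm ((u i - w) ∘ p i) 1 μ + eLpNorm (w ∘ p i - w ∘ q) 1 μ :=
        eLpNorm_sub_le_add_sub (aestronglyMeasurable_comp_of_map_le (hp i) (hle i) (hu i))
          (aestronglyMeasurable_comp_of_map_le (hp i) (hle i) hw.1)
          (aestronglyMeasurable_comp_of_map_le hq (map_le_smul_of_tendsto hp hle hlim) hw.1)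
    _ ≤ C * eLpNorm (u i - w) 1 ν + eLpNorm (w ∘ p i - w ∘ q) 1 μ := by
        gcongr
        exact eLpNorm_one_comp_le_of_map_le (hp i) (hle i) ((hu i).sub hw.1)

end CompositionContinuity

section WeakConvergence

theorem ae_eq_zero_of_forall_integral_smul_eq_zero {Ω E : Type*} [TopologicalSpace Ω]
    [HasOuterApproxClosed Ω] [MeasurableSpace Ω] [BorelSpace Ω] [NormedAddCommGroup E]
    [NormedSpace ℝ E] [CompleteSpace E] {μ : Measure Ω} {w : Ω → E} (hw : Integrable w μ)
    (h : ∀ a : BoundedContinuousFunction Ω ℝ, ∫ t, a t • w t ∂μ = 0) : w =ᵐ[μ] 0 := by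
  refine ae_eq_zero_of_forall_setIntegral_isClosed_eq_zero hw fun s hs => ?_
  have hlim : Tendsto (fun k => ∫ t, (hs.apprSeq k t : ℝ) • w t ∂μ) atTop
      (𝓝 (∫ t, s.indicator w t ∂μ)) := by
    refine tendsto_integral_of_dominated_convergence (fun t => ‖w t‖)
      (fun k => ((NNReal.continuous_coe.comp (hs.apprSeq k).continuous).measurable
        |>.aestronglyMeasurable.smul hw.1)) hw.norm (fun k => ae_of_all _ fun t => ?_)
      (ae_of_all _ fun t => ?_)
    · rw [norm_smul, NNReal.norm_eq]
      exact mul_le_of_le_one_left (norm_nonneg _)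
        (HasOuterApproxClosed.apprSeq_apply_le_one hs k t)
    · have := ((NNReal.continuous_coe.tendsto _).comp
        ((tendsto_pi_nhds.1 (HasOuterApproxClosed.tendsto_apprSeq hs)) t)).smul_const (w t)
      convert! this using 2
      by_cases ht : t ∈ s <;> simp [ht]
  rw [← integral_indicator hs.measurableSet]
  refine tendsto_nhds_unique hlim (tendsto_const_nhds.congr fun k => ?_)
  exact (h (BoundedContinuousFunction.ofNormedAddCommGroup _
    (NNReal.continuous_coe.comp (hs.apprSeq k).continuous) 1 fun t => by
      simpa using HasOuterApproxClosed.apprSeq_apply_le_one hs k t)).symm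

variable {ι Y : Type*} {l : Filter ι} [TopologicalSpace Y] [CompactSpace Y] [MeasurableSpace Y]

theorem exists_tendsto_of_forall_exists_tendsto_integral [BorelSpace Y]
    [TopologicalSpace.MetrizableSpace Y] [l.NeBot] {P : ι → ProbabilityMeasure Y}
    (h : ∀ ψ : BoundedContinuousFunction Y ℝ, ∃ c, Tendsto (fun i => ∫ y, ψ y ∂(P i)) l (𝓝 c)) :
    ∃ Q, Tendsto P l (𝓝 Q) := by
  obtain ⟨Q, hQ⟩ := exists_clusterPt_of_compactSpace (l.map P)
  refine ⟨Q, ProbabilityMeasure.tendsto_iff_forall_integral_tendsto.2 fun ψ => ?_⟩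
  obtain ⟨c, hc⟩ := h ψ
  have hcont : Continuous fun R : ProbabilityMeasure Y => ∫ y, ψ y ∂(R : Measure Y) :=
    continuous_iff_continuousAt.2 fun R =>
      ProbabilityMeasure.tendsto_iff_forall_integral_tendsto.1 tendsto_id ψ
  have hcluster : MapClusterPt (∫ y, ψ y ∂(Q : Measure Y)) l fun i => ∫ y, ψ y ∂(P i : Measure Y) :=
    MapClusterPt.continuousAt_comp hcont.continuousAt hQ
  rwa [← eq_of_nhds_neBot (hcluster.clusterPt.mono hc)] at hc

theorem tendsto_integral_of_dense [OpensMeasurableSpace Y] {P : ι → Measure Y}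
    [∀ i, IsProbabilityMeasure (P i)] {Q : Measure Y} [IsProbabilityMeasure Q]
    {D : Set C(Y, ℝ)} (hD : Dense D)
    (h : ∀ φ ∈ D, Tendsto (fun i => ∫ y, φ y ∂(P i)) l (𝓝 (∫ y, φ y ∂Q))) (φ : C(Y, ℝ)) :
    Tendsto (fun i => ∫ y, φ y ∂(P i)) l (𝓝 (∫ y, φ y ∂Q)) := by
  have hlip : ∀ (ν : Measure Y) [IsProbabilityMeasure ν],
      LipschitzWith 1 fun ψ : C(Y, ℝ) => ∫ y, ψ y ∂ν := fun ν _ =>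
    LipschitzWith.mk_one fun ψ χ => by
      have hint : ∀ ξ : C(Y, ℝ), Integrable ξ ν := fun ξ =>
        (BoundedContinuousFunction.mkOfCompact ξ).integrable ν
      rw [dist_eq_norm, ← integral_sub (hint ψ) (hint χ), dist_eq_norm]
      simpa using norm_integral_le_of_norm_le_const (μ := ν)
        (ae_of_all _ fun y => (ψ - χ).norm_coe_le_norm y)
  have hclosed : IsClosed {ψ : C(Y, ℝ) | Tendsto (fun i => ∫ y, ψ y ∂(P i)) l (𝓝 (∫ y, ψ y ∂Q))} :=
    ((LipschitzWith.uniformEquicontinuous (fun i (ψ : C(Y, ℝ)) => ∫ y, ψ y ∂(P i)) 1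
      fun i => hlip (P i)).equicontinuous).isClosed_setOfPred_tendsto (hlip Q).continuous
  exact hclosed.closure_subset_iff.2 h (hD φ)

theorem measurable_coe_of_continuous {Z : Type*} [TopologicalSpace Z] [MeasurableSpace Z]
    [OpensMeasurableSpace Z] {Ω : Type*} [TopologicalSpace Ω] [HasOuterApproxClosed Ω]
    [MeasurableSpace Ω] [BorelSpace Ω] {P : Z → ProbabilityMeasure Ω} (hP : Continuous P) :
    Measurable fun z => (P z : Measure Ω) := by
  refine Measurable.measure_of_isPiSystem_of_isProbabilityMeasure
    (BorelSpace.measurable_eq.trans borel_eq_generateFrom_isClosed) isPiSystem_isClosed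
    fun s hs => ENNReal.measurable_of_tendsto (f := fun k z => ∫⁻ w, (hs.apprSeq k w : ℝ≥0∞) ∂(P z))
      (fun k => (continuous_iff_continuousAt.2 fun z => ?_).measurable) (tendsto_pi_nhds.2 fun z =>
        HasOuterApproxClosed.tendsto_lintegral_apprSeq hs (P z : Measure Ω))
  exact ProbabilityMeasure.tendsto_iff_forall_lintegral_tendsto.1 (hP.tendsto z) (hs.apprSeq k)

end WeakConvergence

section Modification

theorem continuous_of_forall_tendsto_nhdsWithin {X Y : Type*} [TopologicalSpace X]
    [TopologicalSpace Y] [T3Space Y] {s : Set X} {f : X → Y} (hs : Dense s)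
    (hf : ∀ x, Tendsto f (𝓝[s] x) (𝓝 (f x))) : Continuous f := by
  have heq : extendFrom s f = f := funext fun x => extendFrom_eq (hs x) (hf x)
  exact heq ▸ continuous_extendFrom hs fun x => ⟨f x, hf x⟩

theorem memLp_integral_kernel {K Y Ω : Type*} [MeasurableSpace K] [MeasurableSpace Y]
    [MeasurableSpace Ω] {ν : Measure K} [IsFiniteMeasure ν] {η : Kernel Ω Y} [IsMarkovKernel η]
    {φ : K × Y → ℝ} {c : ℝ} (hφ : Measurable φ) (hc : ∀ z, ‖φ z‖ ≤ c) {p : K → Ω}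
    (hp : Measurable p) (q : ℝ≥0∞) : MemLp (fun t => ∫ V, φ (t, V) ∂(η (p t))) q ν :=
  MemLp.of_bound (hφ.stronglyMeasurable.integral_kernel_prod_right'
      (κ := η.comap p hp)).aestronglyMeasurable c
    (ae_of_all _ fun t => by
      simpa using norm_integral_le_of_norm_le_const (μ := η (p t)) (ae_of_all _ fun _ => hc _))

theorem memLp_integral_continuousMap {K Y Ω : Type*} [MeasurableSpace K] [TopologicalSpace Y]
    [CompactSpace Y] [MeasurableSpace Y] [OpensMeasurableSpace Y] [MeasurableSpace Ω]
    {ν : Measure K} [IsFiniteMeasure ν] {η : Kernel Ω Y} [IsMarkovKernel η] (φ : C(Y, ℝ))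
    {p : K → Ω} (hp : Measurable p) (q : ℝ≥0∞) : MemLp (fun t => ∫ V, φ V ∂(η (p t))) q ν :=
  memLp_integral_kernel (φ := fun z => φ z.2) (φ.continuous.measurable.comp measurable_snd)
    (fun z => φ.norm_coe_le_norm z.2) hp q

variable {Z K Y : Type*} [MeasurableSpace Z] [TopologicalSpace K]
  [CompactSpace K] [TopologicalSpace.MetrizableSpace K] [MeasurableSpace K] [BorelSpace K]
  [TopologicalSpace Y] [CompactSpace Y] [TopologicalSpace.MetrizableSpace Y] [MeasurableSpace Y]
  [BorelSpace Y] {ν : Measure K} [IsProbabilityMeasure ν]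

theorem integral_compProd_sectR (η : Kernel (Z × K) Y) [IsMarkovKernel η] (x : Z)
    (ψ : BoundedContinuousFunction (K × Y) ℝ) :
    ∫ z, ψ z ∂(ν ⊗ₘ η.sectR x) = ∫ t, ∫ V, ψ (t, V) ∂(η (x, t)) ∂ν :=
  Measure.integral_compProd (ψ.integrable _)

theorem ae_eq_integral_of_tendsto_compProd {ι : Type*} {l : Filter ι} [l.NeBot]
    [l.IsCountablyGenerated] {κ : ι → Kernel K Y} [∀ i, IsMarkovKernel (κ i)] {κ₀ : Kernel K Y}
    [IsMarkovKernel κ₀]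
    (hκ : ∀ ψ : BoundedContinuousFunction (K × Y) ℝ,
      Tendsto (fun i => ∫ z, ψ z ∂(ν ⊗ₘ κ i)) l (𝓝 (∫ z, ψ z ∂(ν ⊗ₘ κ₀))))
    {φ : C(Y, ℝ)} {v : K → ℝ} (hv : MemLp v 1 ν)
    (hvlim : Tendsto (fun i => eLpNorm ((fun t => ∫ V, φ V ∂(κ i t)) - v) 1 ν) l (𝓝 0)) :
    v =ᵐ[ν] fun t => ∫ V, φ V ∂(κ₀ t) := by
  have hmem : ∀ (κ : Kernel K Y) [IsMarkovKernel κ],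
      Integrable (fun t => ∫ V, φ V ∂(κ t)) ν := fun κ _ =>
    memLp_one_iff_integrable.1 (memLp_integral_continuousMap φ measurable_id 1)
  have hv' := memLp_one_iff_integrable.1 hv
  refine sub_ae_eq_zero _ _ |>.1 (ae_eq_zero_of_forall_integral_smul_eq_zero
    (hv'.sub (hmem κ₀)) fun a => ?_)
  have ha : AEStronglyMeasurable a ν := a.continuous.measurable.aestronglyMeasurable
  have hmul : ∀ {w : K → ℝ}, Integrable w ν → Integrable (fun t => a t • w t) ν := fun hw =>
    hw.bdd_mul (c := ‖a‖) ha (ae_of_all _ a.norm_coe_le_norm)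
  let ψ : BoundedContinuousFunction (K × Y) ℝ :=
    BoundedContinuousFunction.mkOfCompact ⟨fun z => a z.1 * φ z.2, by fun_prop⟩
  have hψ : ∀ (κ : Kernel K Y) [IsMarkovKernel κ],
      ∫ z, ψ z ∂(ν ⊗ₘ κ) = ∫ t, a t • ∫ V, φ V ∂(κ t) ∂ν := fun κ _ => by
    rw [Measure.integral_compProd (ψ.integrable _)]
    exact integral_congr_ae (ae_of_all _ fun t => integral_const_mul (a t) φ)
  have hlim₀ := hκ ψ
  simp only [hψ] at hlim₀
  have hlim : Tendsto (fun i => ∫ t, a t • ∫ V, φ V ∂(κ i t) ∂ν) l (𝓝 (∫ t, a t • v t ∂ν)) :=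
    tendsto_integral_of_L1' _ (ha.smul hv.1) (Eventually.of_forall fun i => hmul (hmem (κ i)))
      (tendsto_eLpNorm_one_smul_sub_smul (a := fun _ => a) (fun _ => ha) ha
        (fun _ => a.norm_coe_le_norm) (fun _ => tendsto_const_nhds) (fun i => (hmem (κ i)).1) hv
        hvlim)
  simp only [Pi.sub_apply, smul_sub]
  rw [integral_sub (hmul hv') (hmul (hmem κ₀)), tendsto_nhds_unique hlim hlim₀, sub_self]

variable [TopologicalSpace Z] {D : Set Z}

theorem exists_continuous_extension_compProd (η : Kernel (Z × K) Y) [IsMarkovKernel η]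
    (hD : Dense D) (hη : ∀ ψ : BoundedContinuousFunction (K × Y) ℝ, ∀ x₀, ∃ v, MemLp v 1 ν ∧
      Tendsto (fun x => eLpNorm ((fun t => ∫ V, ψ (t, V) ∂(η (x, t))) - v) 1 ν) (𝓝[D] x₀) (𝓝 0)) :
    ∃ E : Z → ProbabilityMeasure (K × Y), Continuous E ∧
      ∀ x ∈ D, (E x : Measure (K × Y)) = ν ⊗ₘ η.sectR x := by
  let P : Z → ProbabilityMeasure (K × Y) := fun x => ⟨ν ⊗ₘ η.sectR x, inferInstance⟩
  have hlim : ∀ x₀, ∃ Q, Tendsto P (𝓝[D] x₀) (𝓝 Q) := fun x₀ => by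
    have := mem_closure_iff_nhdsWithin_neBot.1 (hD x₀)
    refine exists_tendsto_of_forall_exists_tendsto_integral fun ψ => ?_
    obtain ⟨v, hv, hvlim⟩ := hη ψ x₀
    refine ⟨∫ t, v t ∂ν, (tendsto_integral_of_L1' v hv.1 (Eventually.of_forall fun x =>
      memLp_one_iff_integrable.1 (memLp_integral_kernel ψ.continuous.measurable
        ψ.norm_coe_le_norm measurable_prodMk_left 1)) hvlim).congr fun x => ?_⟩
    exact (integral_compProd_sectR η x ψ).symm
  refine ⟨extendFrom D P, continuous_extendFrom hD hlim, fun x hx => ?_⟩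
  obtain ⟨Q, hQ⟩ := hlim x
  have hPQ : P x = Q :=
    tendsto_nhds_unique (tendsto_pure_nhds P x) (hQ.mono_left (pure_le_nhdsWithin hx))
  rw [extendFrom_eq (hD x) hQ, ← hPQ]
  rfl

omit [MeasurableSpace Z] [CompactSpace K] in
theorem fst_eq_of_dense {E : Z → ProbabilityMeasure (K × Y)} (hE : Continuous E) (hD : Dense D)
    (h : ∀ x ∈ D, (E x : Measure (K × Y)).fst = ν) (x : Z) :
    (E x : Measure (K × Y)).fst = ν := by
  have hcont : Continuous fun x => (E x).map (measurable_fst (α := K) (β := Y)).aemeasurable :=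
    (ProbabilityMeasure.continuous_map continuous_fst).comp hE
  let N : ProbabilityMeasure K := ⟨ν, inferInstance⟩
  have heq := hcont.ext_on hD (continuous_const (y := N)) fun y hy => Subtype.ext (h y hy)
  exact congrArg Subtype.val (congrFun heq x)

omit [IsProbabilityMeasure ν] in
theorem exists_isMarkovKernel_compProd_sectR [OpensMeasurableSpace Z] [StandardBorelSpace Y]
    [Nonempty Y] {E : Z → ProbabilityMeasure (K × Y)} (hE : Continuous E)
    (hfst : ∀ x, (E x : Measure (K × Y)).fst = ν) :
    ∃ m : Kernel (Z × K) Y, IsMarkovKernel m ∧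
      ∀ x, (E x : Measure (K × Y)) = ν ⊗ₘ m.sectR x := by
  let ξ : Kernel Z (K × Y) := ⟨fun x => (E x : Measure (K × Y)), measurable_coe_of_continuous hE⟩
  have : IsMarkovKernel ξ := ⟨fun x => (E x).2⟩
  have : StandardBorelSpace K := by
    let := TopologicalSpace.metrizableSpaceMetric K
    infer_instance
  refine ⟨ξ.condKernel, inferInstance, fun x => ?_⟩
  have h := congrArg (fun κ : Kernel Z (K × Y) => κ x) (ξ.disintegrate ξ.condKernel)
  simp only [Kernel.compProd_apply_eq_compProd_sectR, Kernel.fst_apply] at h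
  rw [show (ξ x).map Prod.fst = ν from hfst x] at h
  exact h.symm

theorem exists_modification_tendsto_eLpNorm [FirstCountableTopology Z] [OpensMeasurableSpace Z]
    [Nonempty Y] (η : Kernel (Z × K) Y) [IsMarkovKernel η] (hD : Dense D)
    (hη : ∀ ψ : BoundedContinuousFunction (K × Y) ℝ, ∀ x₀, ∃ v, MemLp v 1 ν ∧
      Tendsto (fun x => eLpNorm ((fun t => ∫ V, ψ (t, V) ∂(η (x, t))) - v) 1 ν) (𝓝[D] x₀) (𝓝 0)) :
    ∃ m : Kernel (Z × K) Y, IsMarkovKernel m ∧ (∀ x ∈ D, ∀ᵐ t ∂ν, m (x, t) = η (x, t)) ∧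
      ∀ (φ : C(Y, ℝ)) (x₀ : Z), Tendsto (fun x => eLpNorm ((fun t => ∫ V, φ V ∂(m (x, t))) -
        fun t => ∫ V, φ V ∂(m (x₀, t))) 1 ν) (𝓝 x₀) (𝓝 0) := by
  have : StandardBorelSpace Y := by
    let := TopologicalSpace.metrizableSpaceMetric Y
    infer_instance
  obtain ⟨E, hE, hEη⟩ := exists_continuous_extension_compProd η hD hη
  obtain ⟨m, hm, hEm⟩ := exists_isMarkovKernel_compProd_sectR hE
    (fst_eq_of_dense (ν := ν) hE hD fun x hx => by rw [hEη x hx, Measure.fst_compProd])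
  have hmη : ∀ x ∈ D, ∀ᵐ t ∂ν, m (x, t) = η (x, t) := fun x hx =>
    (Kernel.ae_eq_of_compProd_eq ((hEm x).symm.trans (hEη x hx)) :)
  refine ⟨m, hm, hmη, fun φ => ?_⟩
  have hmem : ∀ x, MemLp (fun t => ∫ V, φ V ∂(m (x, t))) 1 ν := fun x =>
    memLp_integral_continuousMap φ measurable_prodMk_left 1
  suffices Continuous fun x => (hmem x).toLp from fun x₀ =>
    (Lp.tendsto_Lp_iff_tendsto_eLpNorm'' _ hmem _ (hmem x₀)).1 (this.tendsto x₀)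
  refine continuous_of_forall_tendsto_nhdsWithin hD fun x₀ => ?_
  have := mem_closure_iff_nhdsWithin_neBot.1 (hD x₀)
  refine (Lp.tendsto_Lp_iff_tendsto_eLpNorm'' _ hmem _ (hmem x₀)).2 ?_
  let ψ : BoundedContinuousFunction (K × Y) ℝ :=
    BoundedContinuousFunction.mkOfCompact ⟨fun z => φ z.2, by fun_prop⟩
  obtain ⟨v, hv, hvlim⟩ := hη ψ x₀
  have hvlim' : Tendsto (fun x => eLpNorm ((fun t => ∫ V, φ V ∂(m (x, t))) - v) 1 ν)
      (𝓝[D] x₀) (𝓝 0) :=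
    hvlim.congr' <| eventually_nhdsWithin_of_forall fun x hx => eLpNorm_congr_ae <|
      (hmη x hx).mono fun t ht => by
        simp only [Pi.sub_apply, ht]
        rfl
  have hv₀ : v =ᵐ[ν] fun t => ∫ V, φ V ∂(m (x₀, t)) :=
    ae_eq_integral_of_tendsto_compProd (κ := fun x => m.sectR x) (κ₀ := m.sectR x₀) (fun ψ => by
      simpa only [← hEm] using
        ProbabilityMeasure.tendsto_iff_forall_integral_tendsto.1
          ((hE.tendsto x₀).mono_left nhdsWithin_le_nhds) ψ) hv hvlim'
  exact hvlim'.congr fun x => eLpNorm_congr_ae (hv₀.mono fun t ht => by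
    simp only [Pi.sub_apply, ht])

end Modification

section Gap

variable {𝕜 E : Type*} [RCLike 𝕜] [NormedAddCommGroup E] [InnerProductSpace 𝕜 E]
  {U V : Submodule 𝕜 E} [U.HasOrthogonalProjection] [V.HasOrthogonalProjection] {a b : ℝ}

theorem norm_sub_starProjection_le {v w : E} (hw : w ∈ U) :
    ‖v - U.starProjection v‖ ≤ ‖v - w‖ :=
  U.starProjection_minimal v |>.trans_le <|
    ciInf_le (f := fun x : U => ‖v - x‖) ⟨0, by rintro _ ⟨x, rfl⟩; positivity⟩ ⟨w, hw⟩

theorem norm_one_sub_starProjection_mul_le (ha : 0 ≤ a)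
    (h : ∀ v ∈ U, ∃ w ∈ V, ‖v - w‖ ≤ a * ‖v‖) :
    ‖(1 - V.starProjection) * U.starProjection‖ ≤ a := by
  refine ContinuousLinearMap.opNorm_le_bound _ ha fun v => ?_
  obtain ⟨w, hw, hvw⟩ := h _ (U.starProjection_apply_mem v)
  calc ‖U.starProjection v - V.starProjection (U.starProjection v)‖
      ≤ ‖U.starProjection v - w‖ := norm_sub_starProjection_le hw
    _ ≤ a * ‖U.starProjection v‖ := hvw
    _ ≤ a * ‖v‖ := by gcongr; exact U.norm_starProjection_apply_le v

theorem norm_starProjection_sub_starProjection_le [CompleteSpace E] (ha : 0 ≤ a) (hb : 0 ≤ b)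
    (hUV : ∀ v ∈ U, ∃ w ∈ V, ‖v - w‖ ≤ a * ‖v‖) (hVU : ∀ v ∈ V, ∃ w ∈ U, ‖v - w‖ ≤ b * ‖v‖) :
    ‖U.starProjection - V.starProjection‖ ≤ a + b := by
  have hstar : U.starProjection * (1 - V.starProjection) =
      star ((1 - V.starProjection) * U.starProjection) := by
    rw [star_mul, star_sub, star_one, (isSelfAdjoint_starProjection U).star_eq,
      (isSelfAdjoint_starProjection V).star_eq]
  have hdiff : U.starProjection - V.starProjection =
      U.starProjection * (1 - V.starProjection) - (1 - U.starProjection) * V.starProjection := by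
    noncomm_ring
  rw [hdiff, hstar]
  refine (norm_sub_le _ _).trans (add_le_add ?_ (norm_one_sub_starProjection_mul_le hb hVU))
  rw [ContinuousLinearMap.star_eq_adjoint, LinearIsometryEquiv.norm_map]
  exact norm_one_sub_starProjection_mul_le ha hUV

end Gap

namespace Grass

variable {l d : ℕ}

/-- The orthogonal projection onto a subspace, as an operator. -/
noncomputable def proj (V : Grass l d) : EuclideanSpace ℂ (Fin d) →L[ℂ] EuclideanSpace ℂ (Fin d) :=
  V.1.starProjection

theorem isInducing_proj : IsInducing (proj : Grass l d → _) := ⟨rfl⟩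

theorem proj_injective : Function.Injective (proj : Grass l d → _) :=
  fun _ _ h => Subtype.ext (Submodule.starProjection_inj.1 h)

theorem isEmbedding_proj : IsEmbedding (proj : Grass l d → _) := ⟨isInducing_proj, proj_injective⟩

theorem trace_proj (V : Grass l d) :
    LinearMap.trace ℂ (EuclideanSpace ℂ (Fin d)) (proj V).toLinearMap = l := by
  have h : LinearMap.IsProj V.1 (proj V).toLinearMap :=
    ⟨fun x => V.1.starProjection_apply_mem x, fun x hx => Submodule.starProjection_eq_self_iff.2 hx⟩
  rw [h.trace, V.2]

theorem range_proj : Set.range (proj : Grass l d → _) =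
    {T | IsStarProjection T ∧
      LinearMap.trace ℂ (EuclideanSpace ℂ (Fin d)) T.toLinearMap = l} := by
  ext T
  refine ⟨?_, fun ⟨hT, htrace⟩ => ?_⟩
  · rintro ⟨V, rfl⟩
    exact ⟨isStarProjection_starProjection, trace_proj V⟩
  · obtain ⟨_, hTrange⟩ := isStarProjection_iff_eq_starProjection_range.1 hT
    have hproj : LinearMap.IsProj T.range T.toLinearMap := by
      refine ⟨fun x => ⟨x, rfl⟩, ?_⟩
      rintro _ ⟨x, rfl⟩
      exact DFunLike.congr_fun hT.isIdempotentElem.eq x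
    have hrank : Module.finrank ℂ T.range = l := by
      exact_mod_cast hproj.trace.symm.trans htrace
    exact ⟨⟨T.range, hrank⟩, hTrange.symm⟩

theorem isClosedEmbedding_proj : IsClosedEmbedding (proj : Grass l d → _) := by
  refine ⟨isEmbedding_proj, ?_⟩
  simp only [range_proj, isStarProjection_iff, IsIdempotentElem, IsSelfAdjoint]
  refine ((isClosed_eq (by fun_prop) continuous_id).inter
    (isClosed_eq ContinuousLinearMap.adjoint.continuous continuous_id)).inter
    (isClosed_eq ?_ continuous_const)
  exact LinearMap.continuous_of_finiteDimensional
    ((LinearMap.trace ℂ (EuclideanSpace ℂ (Fin d))) ∘ₗ ContinuousLinearMap.coeLM ℂ)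

instance : CompactSpace (Grass l d) := by
  refine ⟨isInducing_proj.isCompact_iff.2 ?_⟩
  rw [Set.image_univ]
  refine Metric.isCompact_of_isClosed_isBounded isClosedEmbedding_proj.isClosed_range
    ((Metric.isBounded_iff_subset_closedBall 0).2 ⟨1, ?_⟩)
  rintro _ ⟨V, rfl⟩
  rw [mem_closedBall_zero_iff]
  exact V.1.starProjection_norm_le

noncomputable instance : MetricSpace (Grass l d) :=
  isEmbedding_proj.comapMetricSpace _

theorem dist_eq (V W : Grass l d) : dist V W = ‖proj V - proj W‖ := dist_eq_norm (proj V) (proj W)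

variable {B : EuclideanSpace ℂ (Fin d) ≃L[ℂ] EuclideanSpace ℂ (Fin d)}

theorem dist_map_le
    (hB : ‖(B : EuclideanSpace ℂ (Fin d) →L[ℂ] EuclideanSpace ℂ (Fin d)) -
      ContinuousLinearMap.id ℂ (EuclideanSpace ℂ (Fin d))‖ ≤ 1 / 2) (V : Grass l d) :
    dist (Grass.map B V) V ≤ 3 * ‖(B : EuclideanSpace ℂ (Fin d) →L[ℂ] EuclideanSpace ℂ (Fin d)) -
      ContinuousLinearMap.id ℂ (EuclideanSpace ℂ (Fin d))‖ := by
  set δ := ‖(B : EuclideanSpace ℂ (Fin d) →L[ℂ] EuclideanSpace ℂ (Fin d)) -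
    ContinuousLinearMap.id ℂ (EuclideanSpace ℂ (Fin d))‖
  have hδ : 0 ≤ δ := norm_nonneg _
  have hdiff : ∀ v, ‖B v - v‖ ≤ δ * ‖v‖ :=
    ((B : EuclideanSpace ℂ (Fin d) →L[ℂ] EuclideanSpace ℂ (Fin d)) -
      ContinuousLinearMap.id ℂ (EuclideanSpace ℂ (Fin d))).le_opNorm
  have hnorm : ∀ v, ‖v‖ ≤ 2 * ‖B v‖ := fun v => by
    nlinarith [hdiff v, norm_sub_norm_le v (B v), norm_sub_rev v (B v), norm_nonneg v]
  have hfrom : ∀ u ∈ (Grass.map B V).1, ∃ v ∈ V.1, ‖u - v‖ ≤ 2 * δ * ‖u‖ := by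
    rintro _ ⟨v, hv, rfl⟩
    refine ⟨v, hv, (hdiff v).trans ?_⟩
    calc δ * ‖v‖ ≤ δ * (2 * ‖B v‖) := by gcongr; exact hnorm v
      _ = 2 * δ * ‖B v‖ := by ring
  have hto : ∀ v ∈ V.1, ∃ u ∈ (Grass.map B V).1, ‖v - u‖ ≤ δ * ‖v‖ := fun v hv =>
    ⟨B v, Submodule.mem_map_of_mem hv, norm_sub_rev v (B v) ▸ hdiff v⟩
  calc dist (Grass.map B V) V ≤ 2 * δ + δ := by
        rw [dist_eq]
        exact norm_starProjection_sub_starProjection_le (by positivity) hδ hfrom hto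
    _ = 3 * δ := by ring

end Grass

section RiemannianLipschitz

variable {n : ℕ} {K : Type*} [MetricSpace K] [ChartedSpace (EuclideanSpace ℝ (Fin n)) K]
  [RiemannianBundle (fun t : K => TangentSpace (𝓡 n) t)]
  {φ : K → K} {C : ℝ≥0}

open Manifold in
theorem pathELength_comp_le (hφ : MDifferentiable (𝓡 n) (𝓡 n) φ)
    (hC : ∀ t, ‖mfderiv (𝓡 n) (𝓡 n) φ t‖ ≤ C) {γ : ℝ → K} (hγ : MDifferentiable 𝓘(ℝ, ℝ) (𝓡 n) γ)
    (a b : ℝ) : pathELength (𝓡 n) (φ ∘ γ) a b ≤ C * pathELength (𝓡 n) γ a b := by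
  rw [pathELength_eq_lintegral_mfderiv_Icc, pathELength_eq_lintegral_mfderiv_Icc,
    ← lintegral_const_mul' _ _ ENNReal.coe_ne_top]
  refine lintegral_mono fun s => ?_
  rw [mfderiv_comp s (hφ _) (hγ s), ← ofReal_norm, ← ofReal_norm, ← ENNReal.ofReal_coe_nnreal]
  exact (ENNReal.ofReal_le_ofReal
    ((mfderiv (𝓡 n) (𝓡 n) φ (γ s)).le_of_opNorm_le (hC (γ s)) _)).trans_eq (ENNReal.ofReal_mul C.2)

open Manifold in
theorem lipschitzWith_of_norm_mfderiv_le [IsRiemannianManifold (𝓡 n) K]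
    (hφ : ContMDiff (𝓡 n) (𝓡 n) 1 φ) (hC : ∀ t, ‖mfderiv (𝓡 n) (𝓡 n) φ t‖ ≤ C) :
    LipschitzWith C φ := by
  intro x y
  have hbound : ∀ r > edist x y, edist (φ x) (φ y) ≤ C * r := fun r hr => by
    rw [IsRiemannianManifold.out (I := 𝓡 n)] at hr ⊢
    obtain ⟨γ, hγ₀, hγ₁, hγ, hlen, -, -⟩ :=
      exists_lt_locally_constant_of_riemannianEDist_lt hr zero_lt_one
    calc riemannianEDist (𝓡 n) (φ x) (φ y) ≤ pathELength (𝓡 n) (φ ∘ γ) 0 1 :=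
          riemannianEDist_le_pathELength (hφ.comp hγ).contMDiffOn (by simp [hγ₀]) (by simp [hγ₁])
            zero_le_one
      _ ≤ C * pathELength (𝓡 n) γ 0 1 := pathELength_comp_le (hφ.mdifferentiable one_ne_zero) hC
          (hγ.mdifferentiable one_ne_zero) 0 1
      _ ≤ C * r := by gcongr
  have : (𝓝[>] edist x y).NeBot := nhdsGT_neBot_of_exists_gt ⟨⊤, edist_lt_top x y⟩
  exact ge_of_tendsto ((ENNReal.Tendsto.const_mul tendsto_id (Or.inr ENNReal.coe_ne_top)).mono_left
    nhdsWithin_le_nhds) (eventually_nhdsWithin_of_forall (s := Set.Ioi _) hbound)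

end RiemannianLipschitz

section Shift

variable {X : Set ℕ}

theorem shiftBy_zero (x : ℤ → X) : shiftBy 0 x = x := by
  funext k; simp [shiftBy]

theorem shiftBy_shiftBy (a b : ℤ) (x : ℤ → X) : shiftBy a (shiftBy b x) = shiftBy (b + a) x := by
  funext k; simp only [shiftBy]; congr 1; ring

theorem continuous_shiftBy (a : ℤ) : Continuous (shiftBy a : (ℤ → X) → (ℤ → X)) :=
  continuous_pi fun k => continuous_apply (k + a)

theorem continuous_future : Continuous (future : (ℤ → X) → (ℕ → X)) :=
  continuous_pi fun k => continuous_apply (k : ℤ)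

theorem continuous_glue : Continuous fun p : (ℕ → X) × (ℕ → X) => glue p.1 p.2 := by
  refine continuous_pi fun k => ?_
  cases k with
  | ofNat k => exact (continuous_apply k).comp continuous_snd
  | negSucc k => exact (continuous_apply k).comp continuous_fst

theorem future_glue (xs xu : ℕ → X) : future (glue xs xu) = xu := rfl

theorem glue_surjective : Function.Surjective fun p : (ℕ → X) × (ℕ → X) => glue p.1 p.2 := by
  intro x
  refine ⟨(fun k => x (Int.negSucc k), future x), ?_⟩
  funext k
  cases k <;> rfl

theorem glue_eq_of_lt {x y : ℕ → X} {N : ℕ} (h : ∀ k < N, x k = y k) (xs : ℕ → X) {k : ℤ}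
    (hk : k < N) : glue xs x k = glue xs y k := by
  cases k with
  | ofNat k => exact h k (by simpa using hk)
  | negSucc k => rfl

theorem glue_eq_of_neg (xs x y : ℕ → X) {k : ℤ} (hk : k < 0) : glue xs x k = glue xs y k :=
  glue_eq_of_lt (N := 0) (by simp) xs (by exact_mod_cast hk)

theorem shiftDist_nonneg (x y : ℤ → X) : 0 ≤ shiftDist x y :=
  tsum_nonneg fun k => by split_ifs <;> positivity

theorem shiftDist_le {x y : ℤ → X} {N : ℕ} (h : ∀ k : ℤ, k < N → x k = y k) :
    shiftDist x y ≤ 2 * (1 / 2) ^ N := by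
  classical
  unfold shiftDist
  have hinj : Function.Injective fun j : ℕ => (N : ℤ) + j := fun a b hab => by
    simpa using hab
  rw [← hinj.tsum_eq]
  · have hg : HasSum (fun j : ℕ => (1 / 2 : ℝ) ^ N * (1 / 2) ^ j) ((1 / 2) ^ N * 2) :=
      hasSum_geometric_two.mul_left _
    rw [mul_comm, ← hg.tsum_eq]
    have hle : ∀ j : ℕ, (if x ((N : ℤ) + j) = y ((N : ℤ) + j) then (0 : ℝ)
        else (1 / 2 : ℝ) ^ ((N : ℤ) + j).natAbs) ≤ (1 / 2 : ℝ) ^ N * (1 / 2) ^ j := fun j => by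
      split_ifs
      · positivity
      · rw [← pow_add]; exact le_of_eq (congrArg _ (by omega))
    refine Summable.tsum_le_tsum (fun j => ?_) (Summable.of_nonneg_of_le (fun j => ?_) (fun j => ?_)
      hg.summable) hg.summable
    · convert hle j
    · split_ifs <;> positivity
    · convert hle j
  · intro k hk
    refine ⟨(k - N).toNat, ?_⟩
    have : (N : ℤ) ≤ k := by
      by_contra hlt
      exact hk (if_pos (h k (not_le.1 hlt)))
    change (N : ℤ) + ((k - N).toNat : ℤ) = k
    omega

theorem shiftDist_shiftBy_neg_le {x y : ℤ → X} {N : ℕ} (h : ∀ k : ℤ, k < N → x k = y k) (m : ℕ) :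
    shiftDist (shiftBy (-m) x) (shiftBy (-m) y) ≤ 2 * (1 / 2) ^ (N + m) :=
  shiftDist_le fun k hk => h _ (by push_cast at hk; omega)

theorem eventually_agree (x : ℕ → X) (N : ℕ) :
    ∀ᶠ y in 𝓝 x, ∀ k < N, y k = x k := by
  have : ∀ k ∈ Finset.range N, ∀ᶠ y : ℕ → X in 𝓝 x, y k = x k := fun k _ =>
    (continuous_apply k).tendsto x (isOpen_discrete {x k} |>.mem_nhds rfl)
  filter_upwards [(Finset.eventually_all (Finset.range N)).2 this] with y hy k hk
  exact hy k (Finset.mem_range.2 hk)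

end Shift

section Dynamics

variable {X : Set ℕ} {n : ℕ} {K : Type*} [MetricSpace K]
  [ChartedSpace (EuclideanSpace ℝ (Fin n)) K]
  [RiemannianBundle (fun t : K => TangentSpace (𝓡 n) t)]

namespace SkewProduct

theorem fwd_succ_apply (F : SkewProduct X n K) (x : ℤ → X) (m : ℕ) (t : K) :
    F.fwd x (m + 1) t = F.fib (shiftBy m x) (F.fwd x m t) := rfl

theorem fwd_succ_apply' (F : SkewProduct X n K) (x : ℤ → X) (m : ℕ) (t : K) :
    F.fwd x (m + 1) t = F.fwd (shiftBy 1 x) m (F.fib x t) := by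
  induction m with
  | zero =>
    rw [fwd_succ_apply]
    simp only [Nat.cast_zero, shiftBy_zero]
    rfl
  | succ m ih =>
    rw [fwd_succ_apply, ih, fwd_succ_apply, shiftBy_shiftBy, add_comm (1 : ℤ), Nat.cast_succ]

theorem map_iterate (F : SkewProduct X n K) (m : ℕ) (p : (ℤ → X) × K) :
    F.map^[m] p = (shiftBy m p.1, F.fwd p.1 m p.2) := by
  induction m with
  | zero => exact Prod.ext (shiftBy_zero p.1).symm rfl
  | succ m ih =>
    rw [Function.iterate_succ_apply', ih]
    refine Prod.ext ?_ rfl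
    simp only [SkewProduct.map, shiftBy_shiftBy, Nat.cast_succ]

theorem isHomeomorph_map_iterate (F : SkewProduct X n K) (m : ℕ) : IsHomeomorph F.map^[m] := by
  induction m with
  | zero => exact IsHomeomorph.id
  | succ m ih => rw [Function.iterate_succ']; exact F.isHomeomorph.comp ih

/-- The iterate `F^m` of the skew-product as a homeomorphism of its phase space. -/
noncomputable def iterateHomeomorph (F : SkewProduct X n K) (m : ℕ) :
    (ℤ → X) × K ≃ₜ (ℤ → X) × K :=
  (F.isHomeomorph_map_iterate m).homeomorph

theorem iterateHomeomorph_apply (F : SkewProduct X n K) (m : ℕ) (p : (ℤ → X) × K) :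
    F.iterateHomeomorph m p = (shiftBy m p.1, F.fwd p.1 m p.2) :=
  F.map_iterate m p

theorem iterateHomeomorph_symm_apply (F : SkewProduct X n K) (m : ℕ) (p : (ℤ → X) × K) :
    (F.iterateHomeomorph m).symm p =
      (shiftBy (-m) p.1, (F.fwd (shiftBy (-m) p.1) m).symm p.2) := by
  rw [Homeomorph.symm_apply_eq, iterateHomeomorph_apply, shiftBy_shiftBy, neg_add_cancel,
    shiftBy_zero, Diffeomorph.apply_symm_apply]

theorem continuous_fwd (F : SkewProduct X n K) (m : ℕ) :
    Continuous fun p : (ℤ → X) × K => F.fwd p.1 m p.2 :=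
  (continuous_snd.comp (F.iterateHomeomorph m).continuous).congr fun p => by
    rw [Function.comp_apply, iterateHomeomorph_apply]

theorem continuous_fwd_symm (F : SkewProduct X n K) (m : ℕ) :
    Continuous fun p : (ℤ → X) × K => (F.fwd p.1 m).symm p.2 := by
  have hshift : Continuous fun p : (ℤ → X) × K => (shiftBy m p.1, p.2) :=
    ((continuous_shiftBy m).comp continuous_fst).prodMk continuous_snd
  refine (continuous_snd.comp ((F.iterateHomeomorph m).symm.continuous.comp hshift)).congr
    fun p => ?_
  simp only [Function.comp_apply, iterateHomeomorph_symm_apply, shiftBy_shiftBy, add_neg_cancel,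
    shiftBy_zero]

theorem exists_lipschitzWith [IsRiemannianManifold (𝓡 n) K] {F : SkewProduct X n K}
    (hF : F.MostlyNeutral) :
    ∃ C : ℝ≥0, ∀ x m, LipschitzWith C (F.fwd x m) ∧ LipschitzWith C (F.fwd x m).symm := by
  obtain ⟨C, hC⟩ := hF
  refine ⟨C.toNNReal, fun x m => ⟨?_, ?_⟩⟩
  · exact lipschitzWith_of_norm_mfderiv_le (F.fwd x m).contMDiff_toFun fun t =>
      (hC x (Int.ofNat m) t).trans (Real.le_coe_toNNReal C)
  · refine lipschitzWith_of_norm_mfderiv_le (F.fwd x m).symm.contMDiff_toFun fun t => ?_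
    cases m with
    | zero => exact (hC x 0 t).trans (Real.le_coe_toNNReal C)
    | succ m =>
      have h : ∀ z, shiftBy (Int.negSucc m) z = x →
          ‖mfderiv (𝓡 n) (𝓡 n) (F.fwd x (m + 1)).symm t‖ ≤ C.toNNReal := by
        rintro z rfl
        exact (hC z (Int.negSucc m) t).trans (Real.le_coe_toNNReal C)
      refine h (shiftBy (m + 1 : ℕ) x) ?_
      rw [shiftBy_shiftBy, Int.negSucc_eq]
      simpa using shiftBy_zero x

/-- The maps `(f^{-m}_y)⁻¹ ∘ f^{-m}_x`, whose limit is the strong-unstable holonomy. -/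
noncomputable def holApprox (F : SkewProduct X n K) (x y : ℤ → X) (m : ℕ) (t : K) : K :=
  (F.iter y (-(m : ℤ))).symm (F.iter x (-(m : ℤ)) t)

theorem holApprox_eq (F : SkewProduct X n K) (x y : ℤ → X) (m : ℕ) (t : K) :
    F.holApprox x y m t =
      F.fwd (shiftBy (-m) y) m ((F.fwd (shiftBy (-m) x) m).symm t) := by
  cases m <;> rfl

theorem continuous_holApprox (F : SkewProduct X n K) (m : ℕ) :
    Continuous fun p : ((ℤ → X) × (ℤ → X)) × K => F.holApprox p.1.1 p.1.2 m p.2 := by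
  simp only [holApprox_eq]
  exact (F.continuous_fwd m).comp (((continuous_shiftBy _).comp (by fun_prop)).prodMk
    ((F.continuous_fwd_symm m).comp (((continuous_shiftBy _).comp (by fun_prop)).prodMk
      continuous_snd)))

theorem dist_holApprox_succ_le (F : SkewProduct X n K) {C : ℝ≥0}
    (hC : ∀ x m, LipschitzWith C (F.fwd x m)) {c α : ℝ}
    (hc : ∀ (x y : ℤ → X) (t : K), dist (F.fib x t) (F.fib y t) ≤ c * shiftDist x y ^ α)
    (x y : ℤ → X) (m : ℕ) (t : K) :
    dist (F.holApprox x y m t) (F.holApprox x y (m + 1) t) ≤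
      C * (c * shiftDist (shiftBy (-(m + 1 : ℕ)) x) (shiftBy (-(m + 1 : ℕ)) y) ^ α) := by
  have hs : ∀ z : ℤ → X, shiftBy 1 (shiftBy (-(m + 1 : ℕ)) z) = shiftBy (-m) z := fun z => by
    rw [shiftBy_shiftBy]; congr 1; push_cast; ring
  set v := (F.fwd (shiftBy (-(m + 1 : ℕ)) x) (m + 1)).symm t with hv
  have hu : (F.fwd (shiftBy (-m) x) m).symm t = F.fib (shiftBy (-(m + 1 : ℕ)) x) v := by
    have : F.fwd (shiftBy (-(m + 1 : ℕ)) x) (m + 1) v = t := Diffeomorph.apply_symm_apply _ _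
    rw [fwd_succ_apply', hs] at this
    rw [← this, Diffeomorph.symm_apply_apply]
  rw [holApprox_eq, holApprox_eq, hu, ← hv, fwd_succ_apply', hs]
  refine ((hC _ _).dist_le_mul _ _).trans ?_
  gcongr
  exact hc _ _ _

theorem exists_dist_fib_le (F : SkewProduct X n K) : ∃ c α : ℝ, 0 ≤ c ∧ 0 < α ∧
    ∀ (x y : ℤ → X) (t : K), dist (F.fib x t) (F.fib y t) ≤ c * shiftDist x y ^ α := by
  obtain ⟨α, hα, ⟨c, hc⟩, -⟩ := F.holder
  exact ⟨max c 0, α, le_max_right _ _, hα, fun x y t => (hc x y t).trans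
    (mul_le_mul_of_nonneg_right (le_max_left _ _) (Real.rpow_nonneg (shiftDist_nonneg _ _) _))⟩

theorem exists_dist_holApprox_succ_le_geometric [IsRiemannianManifold (𝓡 n) K]
    {F : SkewProduct X n K} (hF : F.MostlyNeutral) : ∃ c r : ℝ, 0 ≤ r ∧ r < 1 ∧
      ∀ (N : ℕ) (x y : ℤ → X), (∀ k : ℤ, k < N → x k = y k) → ∀ t m,
        dist (F.holApprox x y m t) (F.holApprox x y (m + 1) t) ≤ c * r ^ N * r ^ m := by
  obtain ⟨C, hC⟩ := exists_lipschitzWith hF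
  obtain ⟨c, α, hc0, hα, hc⟩ := F.exists_dist_fib_le
  have hrpow : ∀ k : ℕ, ((1 / 2 : ℝ) ^ k) ^ α = ((1 / 2) ^ α) ^ k := fun k => by
    rw [← Real.rpow_natCast, ← Real.rpow_natCast, ← Real.rpow_mul (by norm_num),
      ← Real.rpow_mul (by norm_num), mul_comm]
  refine ⟨C * c, (1 / 2) ^ α, by positivity, Real.rpow_lt_one (by norm_num) (by norm_num) hα,
    fun N x y hxy t m => ?_⟩
  have hdist : shiftDist (shiftBy (-(m + 1 : ℕ)) x) (shiftBy (-(m + 1 : ℕ)) y) ≤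
      (1 / 2) ^ (N + m) :=
    (shiftDist_shiftBy_neg_le hxy (m + 1)).trans_eq (by ring)
  calc dist (F.holApprox x y m t) (F.holApprox x y (m + 1) t)
      ≤ C * (c * shiftDist (shiftBy (-(m + 1 : ℕ)) x) (shiftBy (-(m + 1 : ℕ)) y) ^ α) :=
        F.dist_holApprox_succ_le (fun x m => (hC x m).1) hc x y m t
    _ ≤ C * (c * ((1 / 2) ^ (N + m)) ^ α) := by
        gcongr
        exact shiftDist_nonneg _ _
    _ = C * c * ((1 / 2) ^ α) ^ N * ((1 / 2) ^ α) ^ m := by rw [hrpow, pow_add]; ring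

theorem dist_holApprox_holApprox_le (F : SkewProduct X n K) {C : ℝ≥0}
    (hC : ∀ x m, LipschitzWith C (F.fwd x m) ∧ LipschitzWith C (F.fwd x m).symm)
    (x x' y : ℤ → X) (m : ℕ) (t : K) :
    dist (F.holApprox x y m t) (F.holApprox x' y m t) ≤
      C * (C * dist (F.holApprox x x' m t) t) := by
  rw [holApprox_eq, holApprox_eq, holApprox_eq]
  refine ((hC _ _).1.dist_le_mul _ _).trans ?_
  gcongr
  have h := (hC (shiftBy (-m) x') m).2.dist_le_mul
    (F.fwd (shiftBy (-m) x') m ((F.fwd (shiftBy (-m) x) m).symm t)) t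
  rwa [Diffeomorph.symm_apply_apply] at h

/-- The strong-unstable holonomy `h^u_{x,y}`, meaningful when `x` and `y` have the same entries in
all negative positions. -/
noncomputable def hol (F : SkewProduct X n K) (x y : ℤ → X) (t : K) : K :=
  have : Nonempty K := ⟨t⟩
  limUnder atTop fun m => F.holApprox x y m t

theorem oneSidedIter_eq_fwd (F : SkewProduct X n K) {f : (ℕ → X) → K → K}
    (hf : ∀ x t, F.fib x t = f (future x) t) (x : ℤ → X) (j : ℕ) (t : K) :
    oneSidedIter f (future x) j t = F.fwd x j t := by
  induction j with
  | zero => rfl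
  | succ j ih =>
    rw [fwd_succ_apply, hf, ← ih]
    simp only [oneSidedIter, Function.comp_apply]
    congr 1

section Holonomy

variable [IsRiemannianManifold (𝓡 n) K] [CompactSpace K] {F : SkewProduct X n K}

theorem tendsto_holApprox (hF : F.MostlyNeutral) {x y : ℤ → X}
    (hxy : ∀ k : ℤ, k < 0 → x k = y k) (t : K) :
    Tendsto (fun m => F.holApprox x y m t) atTop (𝓝 (F.hol x y t)) := by
  obtain ⟨c, r, -, hr1, hstep⟩ := exists_dist_holApprox_succ_le_geometric hF
  have : Nonempty K := ⟨t⟩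
  exact (cauchySeq_of_le_geometric r _ hr1
    (hstep 0 x y (by exact_mod_cast hxy) t)).tendsto_limUnder

theorem wuu_hol (hF : F.MostlyNeutral) {x y : ℤ → X} (hxy : ∀ k : ℤ, k ≤ 0 → x k = y k) (t : K) :
    F.Wuu (x, t) (y, F.hol x y t) :=
  ⟨fun k hk => (hxy k hk).symm, tendsto_holApprox hF (fun k hk => hxy k hk.le) t⟩

theorem exists_dist_hol_le (hF : F.MostlyNeutral) :
    ∃ η : ℕ → ℝ, Tendsto η atTop (𝓝 0) ∧ ∀ (N : ℕ) (x y : ℤ → X),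
      (∀ k : ℤ, k < N → x k = y k) → ∀ t, dist (F.hol x y t) t ≤ η N := by
  obtain ⟨c, r, hr0, hr1, hstep⟩ := exists_dist_holApprox_succ_le_geometric hF
  refine ⟨fun N => c * r ^ N / (1 - r), ?_, fun N x y hxy t => ?_⟩
  · simpa using ((tendsto_pow_atTop_nhds_zero_of_lt_one hr0 hr1).const_mul c).div_const (1 - r)
  · rw [dist_comm]
    exact dist_le_of_le_geometric_of_tendsto₀ r _ hr1 (hstep N x y hxy t)
      (tendsto_holApprox hF (fun k hk => hxy k (by omega)) t)

theorem exists_dist_hol_hol_le (hF : F.MostlyNeutral) :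
    ∃ C : ℝ≥0, ∀ x x' y : ℤ → X, (∀ k : ℤ, k < 0 → x k = y k) → (∀ k : ℤ, k < 0 → x' k = y k) →
      ∀ t, dist (F.hol x y t) (F.hol x' y t) ≤ C * (C * dist (F.hol x x' t) t) := by
  obtain ⟨C, hC⟩ := exists_lipschitzWith hF
  refine ⟨C, fun x x' y hx hx' t => ?_⟩
  have hxx' : ∀ k : ℤ, k < 0 → x k = x' k := fun k hk => (hx k hk).trans (hx' k hk).symm
  exact le_of_tendsto_of_tendsto
    ((tendsto_holApprox hF hx t).dist (tendsto_holApprox hF hx' t))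
    ((((tendsto_holApprox hF hxx' t).dist tendsto_const_nhds).const_mul _).const_mul _)
    (Eventually.of_forall fun m => F.dist_holApprox_holApprox_le hC x x' y m t)

theorem tendsto_hol_left (hF : F.MostlyNeutral) (xs x y : ℕ → X) (t : K) :
    Tendsto (fun x' => F.hol (glue xs x') (glue xs y) t) (𝓝 x)
      (𝓝 (F.hol (glue xs x) (glue xs y) t)) := by
  obtain ⟨η, hη0, hη⟩ := exists_dist_hol_le hF
  obtain ⟨C, hC⟩ := exists_dist_hol_hol_le hF
  have hlim : Tendsto (fun N => (C : ℝ) * (C * η N)) atTop (𝓝 0) := by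
    simpa using (hη0.const_mul (C : ℝ)).const_mul (C : ℝ)
  refine Metric.tendsto_nhds.2 fun ε hε => ?_
  obtain ⟨N, hN⟩ := (hlim.eventually_lt_const hε).exists
  filter_upwards [eventually_agree x N] with x' hx'
  calc dist (F.hol (glue xs x') (glue xs y) t) (F.hol (glue xs x) (glue xs y) t)
      ≤ C * (C * dist (F.hol (glue xs x') (glue xs x) t) t) :=
        hC _ _ _ (fun _ => glue_eq_of_neg _ _ _) (fun _ => glue_eq_of_neg _ _ _) t
    _ ≤ C * (C * η N) := by
        gcongr
        exact hη N _ _ (fun k hk => glue_eq_of_lt hx' xs hk) t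
    _ < ε := hN

theorem measurable_hol [MeasurableSpace K] [BorelSpace K] (hF : F.MostlyNeutral) (x y : ℕ → X) :
    Measurable fun p : (ℕ → X) × K => F.hol (glue p.1 x) (glue p.1 y) p.2 := by
  refine measurable_of_tendsto_metrizable (f := fun m (p : (ℕ → X) × K) =>
    F.holApprox (glue p.1 x) (glue p.1 y) m p.2) (fun m => ?_)
    (tendsto_pi_nhds.2 fun p => tendsto_holApprox hF (fun _ => glue_eq_of_neg _ _ _) p.2)
  have hglue : ∀ z : ℕ → X, Continuous fun p : (ℕ → X) × K => glue p.1 z := fun z =>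
    continuous_glue.comp (continuous_fst.prodMk continuous_const)
  exact ((F.continuous_holApprox m).comp
    (((hglue x).prodMk (hglue y)).prodMk continuous_snd)).measurable

end Holonomy

end SkewProduct

end Dynamics

theorem map_comp_le_smul {Ω Ω' Ω'' : Type*} [MeasurableSpace Ω] [MeasurableSpace Ω']
    [MeasurableSpace Ω''] {μ : Measure Ω} {μ' : Measure Ω'} {μ'' : Measure Ω''} {C C' : ℝ≥0}
    {p : Ω → Ω'} {q : Ω' → Ω''} (hp : Measurable p) (hq : Measurable q)
    (hpC : μ.map p ≤ C • μ') (hqC : μ'.map q ≤ C' • μ'') : μ.map (q ∘ p) ≤ (C * C') • μ'' :=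
  calc μ.map (q ∘ p) = (μ.map p).map q := (Measure.map_map hq hp).symm
    _ ≤ (C • μ').map q := Measure.map_mono hpC hq
    _ = C • μ'.map q := Measure.map_smul _ _ _
    _ ≤ (C * C') • μ'' := by rw [mul_smul]; gcongr

theorem map_prodMap_id_le_smul {Ω K : Type*} [MeasurableSpace Ω] [MeasurableSpace K]
    {β : Measure Ω} {ν : Measure K} [IsProbabilityMeasure β] [IsProbabilityMeasure ν] {C : ℝ≥0}
    {T : Ω × K → Ω × K} {σ : Ω → Ω} (hT : Measurable T) (hσ : Measurable σ)
    (hTσ : ∀ p, (T p).1 = σ p.1) (hle : (β.prod ν).map T ≤ C • β.prod ν) :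
    (β.prod ν).map (Prod.map σ id) ≤ C • β.prod ν := by
  have hfst : (β.prod ν).map Prod.fst = β := by simp
  have hmarginal : β.map σ ≤ C • β :=
    calc β.map σ = (β.prod ν).map (σ ∘ Prod.fst) := by
          rw [← Measure.map_map hσ measurable_fst, hfst]
      _ = ((β.prod ν).map T).map Prod.fst := by
          rw [Measure.map_map measurable_fst hT]
          rw [show σ ∘ Prod.fst = Prod.fst ∘ T from funext fun p => (hTσ p).symm]
      _ ≤ (C • β.prod ν).map Prod.fst := Measure.map_mono hle measurable_fst
      _ = C • β := by rw [Measure.map_smul, hfst]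
  calc (β.prod ν).map (Prod.map σ id) = (β.map σ).prod ν := by
        rw [← Measure.map_prod_map _ _ hσ measurable_id, Measure.map_id]
    _ ≤ (C • β).prod ν := Measure.prod_mono hmarginal le_rfl
    _ = C • β.prod ν := Measure.prod_smul_left _

namespace PartialProduct

variable {X : Set ℕ} {K : Type*} [MetricSpace K] [MeasurableSpace K]

instance (μ : PartialProduct X K) : IsProbabilityMeasure μ.μs := μ.isProb_s
instance (μ : PartialProduct X K) : IsProbabilityMeasure μ.μu := μ.isProb_u
instance (μ : PartialProduct X K) : IsProbabilityMeasure μ.μc := μ.isProb_c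
instance (μ : PartialProduct X K) : μ.μs.IsOpenPosMeasure := μ.openPos_s
instance (μ : PartialProduct X K) : μ.μu.IsOpenPosMeasure := μ.openPos_u

/-- The measure `μs × μu`, regarded as a measure on the two-sided shift space. -/
noncomputable def base (μ : PartialProduct X K) : Measure (ℤ → X) :=
  (μ.μs.prod μ.μu).map fun p => glue p.1 p.2

instance (μ : PartialProduct X K) : IsProbabilityMeasure μ.base :=
  Measure.isProbabilityMeasure_map continuous_glue.aemeasurable

instance (μ : PartialProduct X K) : μ.base.IsOpenPosMeasure :=
  continuous_glue.isOpenPosMeasure_map glue_surjective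

theorem measure_eq (μ : PartialProduct X K) : μ.measure =
    (μ.base.prod μ.μc).withDensity fun p => ENNReal.ofReal (μ.ρ p) := by
  have h := Measure.map_prod_map (μ.μs.prod μ.μu) μ.μc continuous_glue.measurable measurable_id
  rw [Measure.map_id] at h
  rw [base, h]
  rfl

theorem exists_bounds_ρ (μ : PartialProduct X K) :
    ∃ a b : ℝ≥0, 0 < a ∧ ∀ p, a ≤ μ.ρ p ∧ μ.ρ p ≤ b := by
  obtain ⟨a, b, ha, h⟩ := μ.bounded_ρ
  exact ⟨a.toNNReal, b.toNNReal, by simpa using ha,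
    fun p => ⟨(Real.coe_toNNReal a ha.le).trans_le (h p).1, (h p).2.trans (Real.le_coe_toNNReal b)⟩⟩

theorem exists_smul_le_measure_le_smul (μ : PartialProduct X K) : ∃ a b : ℝ≥0, 0 < a ∧
    a • μ.base.prod μ.μc ≤ μ.measure ∧ μ.measure ≤ b • μ.base.prod μ.μc := by
  obtain ⟨a, b, ha, hab⟩ := μ.exists_bounds_ρ
  refine ⟨a, b, ha, ?_, ?_⟩ <;> rw [measure_eq, ENNReal.smul_def, ← withDensity_const]
  · exact withDensity_mono (ae_of_all _ fun p => by
      simpa using ENNReal.ofReal_le_ofReal (hab p).1)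
  · exact withDensity_mono (ae_of_all _ fun p => by
      simpa using ENNReal.ofReal_le_ofReal (hab p).2)

variable [BorelSpace K] {n : ℕ} [ChartedSpace (EuclideanSpace ℝ (Fin n)) K]
  [RiemannianBundle (fun t : K => TangentSpace (𝓡 n) t)]

theorem exists_map_iterateHomeomorph_le (μ : PartialProduct X K) {F : SkewProduct X n K}
    (hμ : MeasurePreserving F.map μ.measure μ.measure) : ∃ C : ℝ≥0, ∀ m,
      (μ.base.prod μ.μc).map (F.iterateHomeomorph m) ≤ C • μ.base.prod μ.μc ∧
      (μ.base.prod μ.μc).map (F.iterateHomeomorph m).symm ≤ C • μ.base.prod μ.μc := by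
  obtain ⟨a, b, ha, hlower, hupper⟩ := μ.exists_smul_le_measure_le_smul
  have hiter : ∀ m, MeasurePreserving (F.iterateHomeomorph m).toMeasurableEquiv
      μ.measure μ.measure := hμ.iterate
  exact ⟨a⁻¹ * b, fun m => ⟨map_le_smul_of_measurePreserving ha (hiter m) hlower hupper,
    map_le_smul_of_measurePreserving ha (hiter m).symm hlower hupper⟩⟩

theorem exists_map_fwd_le (μ : PartialProduct X K) {F : SkewProduct X n K}
    (hμ : MeasurePreserving F.map μ.measure μ.measure) :
    ∃ C : ℝ≥0, ∀ x m, μ.μc.map (F.fwd x m) ≤ C • μ.μc ∧ μ.μc.map (F.fwd x m).symm ≤ C • μ.μc := by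
  obtain ⟨C, hC⟩ := μ.exists_map_iterateHomeomorph_le hμ
  refine ⟨C * C, fun x m => ?_⟩
  have hT := (F.iterateHomeomorph m).measurable
  have hT' := (F.iterateHomeomorph m).symm.measurable
  have hσ : ∀ k : ℤ, Measurable (shiftBy k : (ℤ → X) → (ℤ → X)) := fun k =>
    (continuous_shiftBy k).measurable
  have hshift := map_prodMap_id_le_smul hT (hσ m)
    (fun p => by rw [F.iterateHomeomorph_apply]) (hC m).1
  have hshift' := map_prodMap_id_le_smul hT' (hσ (-m))
    (fun p => by rw [F.iterateHomeomorph_symm_apply]) (hC m).2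
  have hfwd : Prod.map (shiftBy (-m)) id ∘ F.iterateHomeomorph m =
      fun p : (ℤ → X) × K => (p.1, F.fwd p.1 m p.2) := funext fun p => by
    simp only [Function.comp_apply, F.iterateHomeomorph_apply, Prod.map_apply, shiftBy_shiftBy,
      add_neg_cancel, shiftBy_zero, id]
  have hsymm : (F.iterateHomeomorph m).symm ∘ Prod.map (shiftBy m) id =
      fun p : (ℤ → X) × K => (p.1, (F.fwd p.1 m).symm p.2) := funext fun p => by
    simp only [Function.comp_apply, F.iterateHomeomorph_symm_apply, Prod.map_fst,
      Prod.map_snd, shiftBy_shiftBy, add_neg_cancel, shiftBy_zero, id]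
  exact ⟨map_le_smul_of_map_prod_le_smul (h := fun x => F.fwd x m) (F.continuous_fwd m)
      (hfwd ▸ map_comp_le_smul hT ((hσ _).prodMap measurable_id) (hC m).1 hshift') x,
    map_le_smul_of_map_prod_le_smul (h := fun x => (F.fwd x m).symm) (F.continuous_fwd_symm m)
      (hsymm ▸ map_comp_le_smul ((hσ _).prodMap measurable_id) hT' hshift (hC m).2) x⟩

theorem exists_map_hol_le [CompactSpace K] [IsRiemannianManifold (𝓡 n) K]
    (μ : PartialProduct X K) {F : SkewProduct X n K} (hF : F.MostlyNeutral)
    (hμ : MeasurePreserving F.map μ.measure μ.measure) :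
    ∃ C : ℝ≥0, ∀ x y : ℕ → X, (μ.μs.prod μ.μc).map
      (fun p => (p.1, F.hol (glue p.1 x) (glue p.1 y) p.2)) ≤ C • μ.μs.prod μ.μc := by
  obtain ⟨C, hC⟩ := μ.exists_map_fwd_le hμ
  refine ⟨C * C, fun x y => map_prod_le_smul (h := fun xs => F.hol (glue xs x) (glue xs y))
    (SkewProduct.measurable_hol hF x y) fun xs => ?_⟩
  have happrox : ∀ m, F.holApprox (glue xs x) (glue xs y) m =
      F.fwd (shiftBy (-m) (glue xs y)) m ∘ (F.fwd (shiftBy (-m) (glue xs x)) m).symm :=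
    fun m => funext fun t => F.holApprox_eq _ _ m t
  have hfwd : ∀ z m, Measurable (F.fwd z m) := fun z m => (F.fwd z m).continuous.measurable
  have hsymm : ∀ z m, Measurable (F.fwd z m).symm := fun z m =>
    (F.fwd z m).symm.continuous.measurable
  refine map_le_smul_of_tendsto (l := atTop) (p := fun m => F.holApprox (glue xs x) (glue xs y) m)
    (fun m => ?_) (fun m => ?_)
    fun t => SkewProduct.tendsto_holApprox hF (fun _ => glue_eq_of_neg _ _ _) t
  · rw [happrox]; exact (hfwd _ _).comp (hsymm _ _)
  · rw [happrox]; exact map_comp_le_smul (hsymm _ _) (hfwd _ _) (hC _ m).2 (hC _ m).1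

end PartialProduct

theorem compProd_congr_of_absolutelyContinuous_prod {Z K Y : Type*} [MeasurableSpace Z]
    [MeasurableSpace K] [MeasurableSpace Y] {τ : Measure (Z × K)} {μ : Measure Z} {ν : Measure K}
    [SFinite τ] [SFinite ν] {κ η : Kernel (Z × K) Y} [IsSFiniteKernel κ] [IsSFiniteKernel η]
    (hτ : τ ≪ μ.prod ν) (h : ∀ᵐ x ∂μ, ∀ᵐ t ∂ν, κ (x, t) = η (x, t)) : τ ⊗ₘ κ = τ ⊗ₘ η := by
  ext s hs
  rw [Measure.compProd_apply hs, Measure.compProd_apply hs]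
  have hmeas : MeasurableSet {p | κ p (Prod.mk p ⁻¹' s) = η p (Prod.mk p ⁻¹' s)} :=
    measurableSet_eq_fun (Kernel.measurable_kernel_prodMk_left hs)
      (Kernel.measurable_kernel_prodMk_left hs)
  exact lintegral_congr_ae (hτ.ae_le ((Measure.ae_prod_iff_ae_ae hmeas).2
    (h.mono fun x hx => hx.mono fun t ht => by simp only [ht])))

section PastAverages

@[fun_prop]
theorem continuous_glue_comp {X : Set ℕ} {Ω : Type*} [TopologicalSpace Ω] {f g : Ω → ℕ → X}
    (hf : Continuous f) (hg : Continuous g) : Continuous fun w => glue (f w) (g w) :=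
  continuous_glue.comp (hf.prodMk hg)

namespace PartialProduct

variable {X : Set ℕ} {K : Type*} [MetricSpace K] [MeasurableSpace K]

@[fun_prop]
theorem continuous_ρ_comp (μ : PartialProduct X K) {Ω : Type*} [TopologicalSpace Ω]
    {g : Ω → (ℤ → X) × K} (hg : Continuous g) : Continuous fun w => μ.ρ (g w) :=
  μ.continuous_ρ.comp hg

theorem ρ_nonneg (μ : PartialProduct X K) (p : (ℤ → X) × K) : 0 ≤ μ.ρ p := by
  obtain ⟨a, b, -, hab⟩ := μ.exists_bounds_ρ
  exact a.2.trans (hab p).1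

theorem integrable_ρ_glue (μ : PartialProduct X K) (q : (ℕ → X) × K) :
    Integrable (fun xs => μ.ρ (glue xs q.1, q.2)) μ.μs := by
  obtain ⟨a, b, -, hab⟩ := μ.exists_bounds_ρ
  refine Integrable.of_bound (Continuous.aestronglyMeasurable (by fun_prop)) b
    (ae_of_all _ fun xs => ?_)
  rw [Real.norm_of_nonneg (μ.ρ_nonneg _)]
  exact (hab _).2

theorem ρu_mem_Icc (μ : PartialProduct X K) {a b : ℝ} (hab : ∀ p, a ≤ μ.ρ p ∧ μ.ρ p ≤ b)
    (q : (ℕ → X) × K) : μ.ρu q.1 q.2 ∈ Set.Icc a b :=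
  ⟨by simpa [ρu] using
      integral_mono (integrable_const a) (μ.integrable_ρ_glue q) fun _ => (hab _).1,
    by simpa [ρu] using
      integral_mono (μ.integrable_ρ_glue q) (integrable_const b) fun _ => (hab _).2⟩

theorem ρu_pos (μ : PartialProduct X K) (q : (ℕ → X) × K) : 0 < μ.ρu q.1 q.2 := by
  obtain ⟨a, b, ha, hab⟩ := μ.exists_bounds_ρ
  exact (NNReal.coe_pos.2 ha).trans_le (μ.ρu_mem_Icc hab q).1

theorem continuous_ρu (μ : PartialProduct X K) :
    Continuous fun q : (ℕ → X) × K => μ.ρu q.1 q.2 := by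
  obtain ⟨a, b, -, hab⟩ := μ.exists_bounds_ρ
  refine continuous_of_dominated (F := fun (q : (ℕ → X) × K) xs => μ.ρ (glue xs q.1, q.2))
    (bound := fun _ => (b : ℝ)) (fun q => (μ.integrable_ρ_glue q).1)
    (fun q => ae_of_all _ fun xs => ?_) (integrable_const _) (ae_of_all _ fun xs => by fun_prop)
  rw [Real.norm_of_nonneg (μ.ρ_nonneg _)]
  exact (hab _).2

theorem lintegral_ρ_glue (μ : PartialProduct X K) (q : (ℕ → X) × K) :
    ∫⁻ xs, ENNReal.ofReal (μ.ρ (glue xs q.1, q.2)) ∂μ.μs = ENNReal.ofReal (μ.ρu q.1 q.2) :=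
  (ofReal_integral_eq_lintegral_ofReal (μ.integrable_ρ_glue q)
    (ae_of_all _ fun _ => μ.ρ_nonneg _)).symm

/-- The density, with respect to `μs × μc` at `p`, of the conditional law of the past given the
future `x` and the point of `K`. -/
noncomputable def pastDensity (μ : PartialProduct X K) (x : ℕ → X) (p : (ℕ → X) × K) : ℝ :=
  μ.ρ (glue p.1 x, p.2) / μ.ρu x p.2

theorem continuous_pastDensity (μ : PartialProduct X K) :
    Continuous fun z : (ℕ → X) × (ℕ → X) × K => μ.pastDensity z.1 z.2 :=
  Continuous.div (by fun_prop) (μ.continuous_ρu.comp (by fun_prop : Continuous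
    fun z : (ℕ → X) × (ℕ → X) × K => (z.1, z.2.2))) fun z => (μ.ρu_pos (z.1, z.2.2)).ne'

theorem exists_norm_pastDensity_le (μ : PartialProduct X K) :
    ∃ c, ∀ x p, ‖μ.pastDensity x p‖ ≤ c := by
  obtain ⟨a, b, ha, hab⟩ := μ.exists_bounds_ρ
  refine ⟨b / a, fun x p => ?_⟩
  have hu : 0 ≤ μ.ρu x p.2 := (μ.ρu_pos (x, p.2)).le
  rw [pastDensity, Real.norm_of_nonneg (div_nonneg (μ.ρ_nonneg _) hu)]
  exact div_le_div₀ b.2 (hab _).2 (NNReal.coe_pos.2 ha) (μ.ρu_mem_Icc hab (x, p.2)).1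

variable [BorelSpace K]

theorem measurable_glue_prod :
    Measurable fun p : ((ℕ → X) × (ℕ → X)) × K => ((glue p.1.1 p.1.2, p.2) : (ℤ → X) × K) :=
  Continuous.measurable (by fun_prop)

theorem measurable_ofReal_ρ (μ : PartialProduct X K) :
    Measurable fun p => ENNReal.ofReal (μ.ρ p) :=
  μ.continuous_ρ.measurable.ennreal_ofReal

theorem lintegral_measure (μ : PartialProduct X K) {g : (ℤ → X) × K → ℝ≥0∞} (hg : Measurable g) :
    ∫⁻ p, g p ∂μ.measure = ∫⁻ q, ∫⁻ xs, ENNReal.ofReal (μ.ρ (glue xs q.1, q.2)) *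
      g (glue xs q.1, q.2) ∂μ.μs ∂(μ.μu.prod μ.μc) := by
  have hρg := μ.measurable_ofReal_ρ.mul hg
  have hglue : Measurable fun z : (ℕ → X) × (ℕ → X) × K =>
      ((glue z.1 z.2.1, z.2.2) : (ℤ → X) × K) := Continuous.measurable (by fun_prop)
  rw [measure, lintegral_withDensity_eq_lintegral_mul _ μ.measurable_ofReal_ρ hg,
    lintegral_map hρg measurable_glue_prod]
  refine ((measurePreserving_prodAssoc μ.μs μ.μu μ.μc).lintegral_comp (hρg.comp hglue)).trans ?_
  exact lintegral_prod_symm _ (hρg.comp hglue).aemeasurable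

/-- The futures `x` above which the set `S` has full measure: `(xs, x, t) ∈ S` for almost every
past `xs` and almost every `t`. -/
def fullFutures (μ : PartialProduct X K) (S : Set ((ℤ → X) × K)) : Set (ℕ → X) :=
  {x | ∀ᵐ p ∂(μ.μs.prod μ.μc), (glue p.1 x, p.2) ∈ S}

theorem ae_mem_fullFutures (μ : PartialProduct X K) {S : Set ((ℤ → X) × K)}
    (hS : μ.measure Sᶜ = 0) : ∀ᵐ x ∂μ.μu, x ∈ μ.fullFutures S := by
  obtain ⟨a, b, ha, hab⟩ := μ.exists_bounds_ρ
  have hρ : ∀ p, ENNReal.ofReal (μ.ρ p) ≠ 0 := fun p =>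
    (ENNReal.ofReal_pos.2 ((NNReal.coe_pos.2 ha).trans_le (hab p).1)).ne'
  have hglued : ∀ᵐ p ∂((μ.μs.prod μ.μu).prod μ.μc), (glue p.1.1 p.1.2, p.2) ∈ S :=
    ae_of_ae_map measurable_glue_prod.aemeasurable
      ((withDensity_absolutelyContinuous' μ.measurable_ofReal_ρ.aemeasurable
        (ae_of_all _ hρ)).ae_le hS)
  have hswap : MeasurePreserving (fun z : (ℕ → X) × (ℕ → X) × K => ((z.2.1, z.1), z.2.2))
      (μ.μu.prod (μ.μs.prod μ.μc)) ((μ.μs.prod μ.μu).prod μ.μc) :=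
    (Measure.measurePreserving_swap.prod (MeasurePreserving.id μ.μc)).comp
      ((measurePreserving_prodAssoc μ.μu μ.μs μ.μc).symm _)
  exact Measure.ae_ae_of_ae_prod (hswap.quasiMeasurePreserving.ae hglued)

theorem dense_fullFutures (μ : PartialProduct X K) {S : Set ((ℤ → X) × K)}
    (hS : μ.measure Sᶜ = 0) : Dense (μ.fullFutures S) :=
  Measure.dense_of_ae (μ.ae_mem_fullFutures hS)

variable {Y : Type*} [MeasurableSpace Y]

theorem measurable_kernel_glue (κ : Kernel ((ℤ → X) × K) Y) (q : (ℕ → X) × K) :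
    Measurable fun xs : ℕ → X => κ (glue xs q.1, q.2) :=
  κ.measurable.comp (Continuous.measurable (by fun_prop))

/-- The average of a family of measures over the pasts, with respect to their conditional law given
a future and a point of `K`. -/
noncomputable def avg (μ : PartialProduct X K) (κ : Kernel ((ℤ → X) × K) Y) (q : (ℕ → X) × K) :
    Measure Y :=
  (ENNReal.ofReal (μ.ρu q.1 q.2))⁻¹ •
    (μ.μs.withDensity (fun xs => ENNReal.ofReal (μ.ρ (glue xs q.1, q.2)))).bind
      (fun xs => κ (glue xs q.1, q.2))

theorem avg_apply (μ : PartialProduct X K) (κ : Kernel ((ℤ → X) × K) Y) (q : (ℕ → X) × K)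
    {s : Set Y} (hs : MeasurableSet s) :
    μ.avg κ q s = (ENNReal.ofReal (μ.ρu q.1 q.2))⁻¹ *
      ∫⁻ xs, ENNReal.ofReal (μ.ρ (glue xs q.1, q.2)) * κ (glue xs q.1, q.2) s ∂μ.μs := by
  have hρ : Measurable fun xs : ℕ → X => ENNReal.ofReal (μ.ρ (glue xs q.1, q.2)) :=
    (Continuous.measurable (by fun_prop)).ennreal_ofReal
  have hκ : Measurable fun xs : ℕ → X => κ (glue xs q.1, q.2) s :=
    (Measure.measurable_coe hs).comp (measurable_kernel_glue κ q)
  rw [avg, Measure.smul_apply, smul_eq_mul,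
    Measure.bind_apply hs (measurable_kernel_glue κ q).aemeasurable,
    lintegral_withDensity_eq_lintegral_mul _ hρ hκ]
  rfl

/-- The average over the pasts as a kernel. -/
noncomputable def avgKernel (μ : PartialProduct X K) (κ : Kernel ((ℤ → X) × K) Y) :
    Kernel ((ℕ → X) × K) Y where
  toFun := μ.avg κ
  measurable' := by
    refine Measure.measurable_of_measurable_coe _ fun s hs => ?_
    have hglue : Continuous fun z : ((ℕ → X) × K) × (ℕ → X) =>
        ((glue z.2 z.1.1, z.1.2) : (ℤ → X) × K) := by fun_prop
    simp only [avg_apply μ κ _ hs]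
    exact μ.continuous_ρu.measurable.ennreal_ofReal.inv.mul
      ((μ.measurable_ofReal_ρ.mul (κ.measurable_coe hs)).comp
        hglue.measurable).lintegral_prod_right'

theorem avgKernel_apply (μ : PartialProduct X K) (κ : Kernel ((ℤ → X) × K) Y)
    (q : (ℕ → X) × K) : μ.avgKernel κ q = μ.avg κ q := rfl

instance (μ : PartialProduct X K) (κ : Kernel ((ℤ → X) × K) Y) [IsMarkovKernel κ] :
    IsMarkovKernel (μ.avgKernel κ) := by
  refine ⟨fun q => ⟨?_⟩⟩
  rw [avgKernel_apply, avg_apply _ _ _ MeasurableSet.univ]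
  simp only [measure_univ, mul_one]
  rw [lintegral_ρ_glue, ENNReal.inv_mul_cancel (ENNReal.ofReal_pos.2 (μ.ρu_pos q)).ne'
    ENNReal.ofReal_ne_top]

theorem integral_avgKernel (μ : PartialProduct X K) (κ : Kernel ((ℤ → X) × K) Y)
    [IsMarkovKernel κ] [TopologicalSpace Y] [OpensMeasurableSpace Y] (φ : Y →ᵇ ℝ) (x : ℕ → X)
    (t : K) : ∫ V, φ V ∂(μ.avgKernel κ (x, t)) =
      ∫ xs, μ.pastDensity x (xs, t) • ∫ V, φ V ∂(κ (glue xs x, t)) ∂μ.μs := by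
  have hglue : Measurable fun xs : ℕ → X => ((glue xs x, t) : (ℤ → X) × K) :=
    Continuous.measurable (by fun_prop)
  have hρ : Measurable fun xs : ℕ → X => ENNReal.ofReal (μ.ρ (glue xs x, t)) :=
    μ.measurable_ofReal_ρ.comp hglue
  let w := μ.μs.withDensity fun xs => ENNReal.ofReal (μ.ρ (glue xs x, t))
  have : IsFiniteMeasure w := isFiniteMeasure_withDensity_ofReal (μ.integrable_ρ_glue (x, t)).2
  have hbind : ∫ V, φ V ∂(w.bind fun xs => κ (glue xs x, t)) =
      ∫ xs, ∫ V, φ V ∂(κ (glue xs x, t)) ∂w :=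
    Kernel.integral_comp (η := κ.comap _ hglue) (κ := Kernel.const Unit w) (a := ())
      (φ.integrable ((κ.comap _ hglue) ∘ₘ w))
  rw [avgKernel_apply, avg, integral_smul_measure, hbind,
    integral_withDensity_eq_integral_toReal_smul hρ (ae_of_all _ fun _ => ENNReal.ofReal_lt_top),
    ← integral_smul]
  refine integral_congr_ae (ae_of_all _ fun xs => ?_)
  simp only [smul_smul, pastDensity, ENNReal.toReal_inv, ENNReal.toReal_ofReal (μ.ρ_nonneg _),
    ENNReal.toReal_ofReal (μ.ρu_pos (x, t)).le, div_eq_inv_mul]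

/-- The projection of the measure to the space of one-sided sequences. -/
noncomputable def oneSided (μ : PartialProduct X K) : Measure ((ℕ → X) × K) :=
  μ.measure.map fun p => (future p.1, p.2)

theorem measurable_future_prod : Measurable fun p : (ℤ → X) × K => (future p.1, p.2) :=
  ((continuous_future.comp continuous_fst).prodMk continuous_snd).measurable

instance (μ : PartialProduct X K) : IsProbabilityMeasure μ.oneSided :=
  Measure.isProbabilityMeasure_map measurable_future_prod.aemeasurable

theorem lintegral_oneSided (μ : PartialProduct X K) {g : (ℕ → X) × K → ℝ≥0∞} (hg : Measurable g) :
    ∫⁻ q, g q ∂μ.oneSided = ∫⁻ q, ENNReal.ofReal (μ.ρu q.1 q.2) * g q ∂(μ.μu.prod μ.μc) := by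
  have hg' : Measurable fun p : (ℤ → X) × K => g (future p.1, p.2) :=
    hg.comp measurable_future_prod
  rw [oneSided, lintegral_map hg measurable_future_prod, μ.lintegral_measure hg']
  refine lintegral_congr fun q => ?_
  simp only [future_glue]
  rw [lintegral_mul_const _ (Continuous.measurable (by fun_prop)).ennreal_ofReal,
    lintegral_ρ_glue]

theorem oneSided_absolutelyContinuous (μ : PartialProduct X K) : μ.oneSided ≪ μ.μu.prod μ.μc := by
  refine Measure.AbsolutelyContinuous.mk fun s hs h0 => ?_
  rw [← lintegral_indicator_one hs, lintegral_oneSided _ (measurable_one.indicator hs)]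
  refine (lintegral_congr_ae ?_).trans lintegral_zero
  filter_upwards [measure_eq_zero_iff_ae_notMem.1 h0] with q hq
  rw [Set.indicator_of_notMem hq, mul_zero]

theorem oneSided_compProd_avgKernel (μ : PartialProduct X K) (κ : Kernel ((ℤ → X) × K) Y)
    [IsMarkovKernel κ] : μ.oneSided ⊗ₘ μ.avgKernel κ =
      (μ.measure ⊗ₘ κ).map fun z => ((future z.1.1, z.1.2), z.2) := by
  have hm : Measurable fun z : ((ℤ → X) × K) × Y => ((future z.1.1, z.1.2), z.2) :=
    (measurable_future_prod.comp measurable_fst).prodMk measurable_snd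
  ext s hs
  rw [Measure.map_apply hm hs, Measure.compProd_apply hs, Measure.compProd_apply (hm hs),
    lintegral_oneSided _ (Kernel.measurable_kernel_prodMk_left hs),
    lintegral_measure _ (Kernel.measurable_kernel_prodMk_left (hm hs))]
  refine lintegral_congr fun q => ?_
  rw [avgKernel_apply, avg_apply _ _ _ (measurable_prodMk_left hs), ← mul_assoc,
    ENNReal.mul_inv_cancel (ENNReal.ofReal_pos.2 (μ.ρu_pos q)).ne' ENNReal.ofReal_ne_top, one_mul]
  rfl

theorem oneSided_compProd_of_ae_eq_avgKernel (μ : PartialProduct X K)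
    {κ : Kernel ((ℤ → X) × K) Y} [IsMarkovKernel κ] {m : Kernel ((ℕ → X) × K) Y}
    [IsMarkovKernel m] (h : ∀ᵐ x ∂μ.μu, ∀ᵐ t ∂μ.μc, m (x, t) = μ.avgKernel κ (x, t)) :
    μ.oneSided ⊗ₘ m = (μ.measure ⊗ₘ κ).map fun z => ((future z.1.1, z.1.2), z.2) := by
  rw [← oneSided_compProd_avgKernel]
  exact compProd_congr_of_absolutelyContinuous_prod μ.oneSided_absolutelyContinuous h

end PartialProduct

end PastAverages

section FibreIntegrals

/-- `α`-Hölder dependence of the linear isomorphisms `H p q`, for `q` in the local strong-unstable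
set of `p`. -/
def SkewProduct.IsHolderHolonomy {X : Set ℕ} {n : ℕ} {K : Type*} [MetricSpace K]
    [ChartedSpace (EuclideanSpace ℝ (Fin n)) K]
    [RiemannianBundle (fun t : K => TangentSpace (𝓡 n) t)] {d : ℕ} (F : SkewProduct X n K) (α : ℝ)
    (H : (ℤ → X) × K → (ℤ → X) × K →
      (EuclideanSpace ℂ (Fin d) ≃L[ℂ] EuclideanSpace ℂ (Fin d))) : Prop :=
  ∃ L : ℝ, 0 < L ∧ ∀ p q : (ℤ → X) × K, F.Wuu p q →
    ‖(H p q : EuclideanSpace ℂ (Fin d) →L[ℂ] EuclideanSpace ℂ (Fin d)) -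
        ContinuousLinearMap.id ℂ (EuclideanSpace ℂ (Fin d))‖ ≤ L * totalDist p q ^ α

/-- The integral of `ψ (t, ·)` for the measure that `κ` attaches to the point `(xs, x, t)`, as a
function of the past `xs` and of the point `t` of `K`, the future `x` being fixed. -/
noncomputable def fibreIntegral {X : Set ℕ} {K Y : Type*} [TopologicalSpace K] [MeasurableSpace K]
    [TopologicalSpace Y] [MeasurableSpace Y] (κ : Kernel ((ℤ → X) × K) Y) (ψ : K × Y →ᵇ ℝ)
    (x : ℕ → X) (p : (ℕ → X) × K) : ℝ :=
  ∫ V, ψ (p.2, V) ∂(κ (glue p.1 x, p.2))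

theorem norm_integral_map_sub_integral_le {Y : Type*} [TopologicalSpace Y] [MeasurableSpace Y]
    [OpensMeasurableSpace Y] {P : Measure Y} [IsProbabilityMeasure P] {T : Y → Y}
    [IsProbabilityMeasure (P.map T)] {φ φ' : Y →ᵇ ℝ} {ε : ℝ} (hε : ∀ V, ‖φ' (T V) - φ V‖ ≤ ε) :
    ‖∫ V, φ' V ∂(P.map T) - ∫ V, φ V ∂P‖ ≤ ε := by
  have hT : AEMeasurable T P := aemeasurable_of_map_neZero inferInstance
  have hφ' : Integrable (fun V => φ' (T V)) P :=
    (integrable_map_measure φ'.continuous.measurable.aestronglyMeasurable hT).1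
      (φ'.integrable (P.map T))
  rw [integral_map hT φ'.continuous.measurable.aestronglyMeasurable,
    ← integral_sub hφ' (φ.integrable P)]
  simpa using norm_integral_le_of_norm_le_const (μ := P) (ae_of_all _ hε)

section

variable {X : Set ℕ} {K Y : Type*} [MetricSpace K] [MeasurableSpace K] [BorelSpace K]
  [TopologicalSpace Y] [MeasurableSpace Y] {κ : Kernel ((ℤ → X) × K) Y} [IsMarkovKernel κ]

theorem memLp_fibreIntegral [SecondCountableTopologyEither K Y] [OpensMeasurableSpace Y]
    (μ : PartialProduct X K) (ψ : K × Y →ᵇ ℝ) (x : ℕ → X) (q : ℝ≥0∞) :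
    MemLp (fibreIntegral κ ψ x) q (μ.μs.prod μ.μc) := by
  have hψ : Measurable fun z : ((ℕ → X) × K) × Y => ψ (z.1.2, z.2) :=
    ψ.continuous.measurable.comp (measurable_snd.comp measurable_fst |>.prodMk measurable_snd)
  exact memLp_integral_kernel hψ (fun z => ψ.norm_coe_le_norm _)
    (Continuous.measurable (by fun_prop : Continuous fun p : (ℕ → X) × K => (glue p.1 x, p.2))) q

end

variable {X : Set ℕ} {n : ℕ} {K : Type*} [MetricSpace K] [CompactSpace K]
  [ChartedSpace (EuclideanSpace ℝ (Fin n)) K]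
  [RiemannianBundle (fun t : K => TangentSpace (𝓡 n) t)] [IsRiemannianManifold (𝓡 n) K]
  {F : SkewProduct X n K} {l d : ℕ} {α : ℝ}
  {H : (ℤ → X) × K → (ℤ → X) × K → (EuclideanSpace ℂ (Fin d) ≃L[ℂ] EuclideanSpace ℂ (Fin d))}

theorem SkewProduct.IsHolderHolonomy.exists_norm_hol_sub_id_le (hF : F.MostlyNeutral) (hα : 0 < α)
    (hH : F.IsHolderHolonomy α H) : ∃ θ : ℕ → ℝ, Tendsto θ atTop (𝓝 0) ∧
      ∀ (N : ℕ) (x y : ℤ → X), 1 ≤ N → (∀ k : ℤ, k < N → x k = y k) → ∀ t,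
        ‖(H (x, t) (y, F.hol x y t) : EuclideanSpace ℂ (Fin d) →L[ℂ] EuclideanSpace ℂ (Fin d)) -
          ContinuousLinearMap.id ℂ (EuclideanSpace ℂ (Fin d))‖ ≤ θ N := by
  obtain ⟨η, hη0, hη⟩ := SkewProduct.exists_dist_hol_le hF
  obtain ⟨L, hL, hHol⟩ := hH
  have hdist0 : Tendsto (fun N : ℕ => 2 * (1 / 2 : ℝ) ^ N + η N) atTop (𝓝 0) := by
    simpa using ((tendsto_pow_atTop_nhds_zero_of_lt_one (r := (1 / 2 : ℝ)) (by norm_num)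
      (by norm_num)).const_mul 2).add hη0
  refine ⟨fun N => L * (2 * (1 / 2) ^ N + η N) ^ α, ?_, fun N x y hN hxy t => ?_⟩
  · simpa [Real.zero_rpow hα.ne'] using (hdist0.rpow_const (p := α) (Or.inr hα.le)).const_mul L
  · have hdist : totalDist (x, t) (y, F.hol x y t) ≤ 2 * (1 / 2) ^ N + η N :=
      add_le_add (shiftDist_le hxy) ((dist_comm _ _).trans_le (hη N x y hxy t))
    have hdist_nonneg : 0 ≤ totalDist (x, t) (y, F.hol x y t) :=
      add_nonneg (shiftDist_nonneg _ _) dist_nonneg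
    exact (hHol _ _ (SkewProduct.wuu_hol hF (fun k hk => hxy k (by omega)) t)).trans
      (mul_le_mul_of_nonneg_left (Real.rpow_le_rpow hdist_nonneg hdist hα.le) hL.le)

theorem SkewProduct.IsHolderHolonomy.exists_dist_grassMap_hol_lt (hF : F.MostlyNeutral)
    (hα : 0 < α) (hH : F.IsHolderHolonomy α H) {δ : ℝ} (hδ : 0 < δ) :
    ∃ N : ℕ, 1 ≤ N ∧ ∀ x y : ℤ → X, (∀ k : ℤ, k < N → x k = y k) → ∀ (t : K) (V : Grass l d),
      dist (F.hol x y t, Grass.map (H (x, t) (y, F.hol x y t)) V) (t, V) < δ := by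
  obtain ⟨η, hη0, hη⟩ := SkewProduct.exists_dist_hol_le hF
  obtain ⟨θ, hθ0, hθ⟩ := hH.exists_norm_hol_sub_id_le hF hα
  obtain ⟨N, hN, hηδ, hθ_half, hθδ⟩ := ((eventually_ge_atTop 1).and
    ((hη0.eventually_lt_const hδ).and ((hθ0.eventually_le_const one_half_pos).and
      (hθ0.eventually_lt_const (div_pos hδ three_pos))))).exists
  refine ⟨N, hN, fun x y hxy t V => ?_⟩
  rw [Prod.dist_eq]
  have hHN := hθ N x y hN hxy t
  refine max_lt ((hη N x y hxy t).trans_lt hηδ)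
    ((Grass.dist_map_le (hHN.trans hθ_half) V).trans_lt ?_)
  linarith

variable [MeasurableSpace K] [BorelSpace K] {μ : PartialProduct X K}
  {κ : Kernel ((ℤ → X) × K) (Grass l d)} [IsMarkovKernel κ] {S : Set ((ℤ → X) × K)}

theorem exists_ae_norm_fibreIntegral_hol_sub_le (hF : F.MostlyNeutral)
    (hμ : MeasurePreserving F.map μ.measure μ.measure) (hα : 0 < α)
    (hH : F.IsHolderHolonomy α H)
    (hS : ∀ b ∈ S, ∀ q ∈ S, F.Wuu b q → κ q = (κ b).map (Grass.map (H b q)))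
    (ψ : K × Grass l d →ᵇ ℝ) {ε : ℝ} (hε : 0 < ε) :
    ∃ N : ℕ, ∀ x ∈ μ.fullFutures S, ∀ y ∈ μ.fullFutures S, (∀ k < N, x k = y k) →
      ∀ᵐ p ∂(μ.μs.prod μ.μc),
        ‖fibreIntegral κ ψ y (p.1, F.hol (glue p.1 x) (glue p.1 y) p.2) -
          fibreIntegral κ ψ x p‖ ≤ ε := by
  obtain ⟨C, hC⟩ := μ.exists_map_hol_le hF hμ
  obtain ⟨δ, hδ, hδψ⟩ := Metric.uniformContinuous_iff.1
    (CompactSpace.uniformContinuous_of_continuous ψ.continuous) ε hε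
  obtain ⟨N, hN, hclose⟩ := hH.exists_dist_grassMap_hol_lt (l := l) hF hα hδ
  refine ⟨N, fun x hx y hy hxy => ?_⟩
  have hy' : ∀ᵐ p ∂(μ.μs.prod μ.μc), (glue p.1 y, F.hol (glue p.1 x) (glue p.1 y) p.2) ∈ S :=
    ae_of_ae_map (measurable_fst.prodMk (SkewProduct.measurable_hol hF x y)).aemeasurable
      ((Measure.absolutelyContinuous_of_le_smul (hC x y)).ae_le hy)
  filter_upwards [hx, hy'] with p hpx hpy
  have hglue : ∀ k : ℤ, k < N → glue p.1 x k = glue p.1 y k := fun k hk =>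
    glue_eq_of_lt hxy p.1 hk
  have hκ := hS _ hpx _ hpy (SkewProduct.wuu_hol hF (fun k hk => hglue k (by omega)) p.2)
  have : IsProbabilityMeasure ((κ (glue p.1 x, p.2)).map (Grass.map
      (H (glue p.1 x, p.2) (glue p.1 y, F.hol (glue p.1 x) (glue p.1 y) p.2)))) :=
    hκ ▸ inferInstance
  let slice (t : K) : Grass l d →ᵇ ℝ := ψ.compContinuous ⟨fun V => (t, V), by fun_prop⟩
  have h := norm_integral_map_sub_integral_le (P := κ (glue p.1 x, p.2)) (φ := slice p.2)
    (φ' := slice (F.hol (glue p.1 x) (glue p.1 y) p.2))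
    fun V => (hδψ (hclose _ _ hglue p.2 V)).le
  rwa [← hκ] at h

theorem exists_tendsto_eLpNorm_fibreIntegral_sub (hF : F.MostlyNeutral)
    (hμ : MeasurePreserving F.map μ.measure μ.measure) (hα : 0 < α)
    (hH : F.IsHolderHolonomy α H)
    (hS : ∀ b ∈ S, ∀ q ∈ S, F.Wuu b q → κ q = (κ b).map (Grass.map (H b q)))
    (hdense : Dense (μ.fullFutures S)) (ψ : K × Grass l d →ᵇ ℝ) (x₀ : ℕ → X) :
    ∃ v, MemLp v 1 (μ.μs.prod μ.μc) ∧ Tendsto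
      (fun x => eLpNorm (fibreIntegral κ ψ x - v) 1 (μ.μs.prod μ.μc))
      (𝓝[μ.fullFutures S] x₀) (𝓝 0) := by
  have : (𝓝[μ.fullFutures S] x₀).NeBot := mem_closure_iff_nhdsWithin_neBot.1 (hdense x₀)
  obtain ⟨C, hC⟩ := μ.exists_map_hol_le hF hμ
  have hG : ∀ x, MemLp (fibreIntegral κ ψ x) 1 (μ.μs.prod μ.μc) := fun x =>
    memLp_fibreIntegral μ ψ x 1
  refine exists_memLp_tendsto_eLpNorm_one_sub_of_comp (C := C) (ν := μ.μs.prod μ.μc) hG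
    fun ε hε => ?_
  obtain ⟨δ, hδ, hδε⟩ := ENNReal.lt_iff_exists_nnreal_btwn.1 hε
  obtain ⟨N, hN⟩ := exists_ae_norm_fibreIntegral_hol_sub_le hF hμ hα hH hS ψ
    (NNReal.coe_pos.2 (ENNReal.coe_pos.1 hδ))
  have hagree : ∀ᶠ x in 𝓝[μ.fullFutures S] x₀, ∀ k < N, x k = x₀ k :=
    (eventually_agree x₀ N).filter_mono nhdsWithin_le_nhds
  obtain ⟨y, hyN, hyD⟩ := (hagree.and eventually_mem_nhdsWithin).exists
  refine ⟨fibreIntegral κ ψ y, fun x p => (p.1, F.hol (glue p.1 x) (glue p.1 y) p.2),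
    fun p => (p.1, F.hol (glue p.1 x₀) (glue p.1 y) p.2), hG y,
    fun x => measurable_fst.prodMk (SkewProduct.measurable_hol hF x y), fun x => hC x y,
    fun p => tendsto_const_nhds.prodMk_nhds
      ((SkewProduct.tendsto_hol_left hF p.1 x₀ y p.2).mono_left nhdsWithin_le_nhds), ?_⟩
  filter_upwards [eventually_mem_nhdsWithin, hagree] with x hxD hxN
  rw [eLpNorm_sub_comm]
  have hle := eLpNorm_le_of_ae_bound (p := 1)
    (hN x hxD y hyD fun k hk => (hxN k hk).trans (hyN k hk).symm)
  refine (hle.trans_eq ?_).trans hδε.le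
  simp

end FibreIntegrals

section OneSidedDisintegration

theorem eLpNorm_one_integral_left_sub_le {Ω K E : Type*} [MeasurableSpace Ω] [MeasurableSpace K]
    [NormedAddCommGroup E] [NormedSpace ℝ E] {μ : Measure Ω} {ν : Measure K} [SFinite μ] [SFinite ν]
    {u v : Ω × K → E} (hu : Integrable u (μ.prod ν)) (hv : Integrable v (μ.prod ν)) :
    eLpNorm ((fun t => ∫ s, u (s, t) ∂μ) - fun t => ∫ s, v (s, t) ∂μ) 1 ν ≤
      eLpNorm (u - v) 1 (μ.prod ν) := by
  rw [eLpNorm_one_eq_lintegral_enorm, eLpNorm_one_eq_lintegral_enorm,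
    lintegral_prod_symm _ (hu.sub hv).1.enorm]
  refine lintegral_mono_ae ?_
  filter_upwards [hu.prod_left_ae, hv.prod_left_ae] with t hut hvt
  rw [Pi.sub_apply, ← integral_sub hut hvt]
  exact enorm_integral_le_lintegral_enorm _

namespace PartialProduct

section

variable {X : Set ℕ} {K Y : Type*} [MetricSpace K] [MeasurableSpace K] [BorelSpace K]
  [TopologicalSpace Y] [MeasurableSpace Y] [OpensMeasurableSpace Y]
  {κ : Kernel ((ℤ → X) × K) Y} [IsMarkovKernel κ]

theorem integral_avgKernel_eq_integral_fibreIntegral (μ : PartialProduct X K) (ψ : K × Y →ᵇ ℝ)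
    (x : ℕ → X) (t : K) : ∫ V, ψ (t, V) ∂(μ.avgKernel κ (x, t)) =
      ∫ xs, (μ.pastDensity x • fibreIntegral κ ψ x) (xs, t) ∂μ.μs :=
  μ.integral_avgKernel κ (ψ.compContinuous ⟨fun V => (t, V), by fun_prop⟩) x t

theorem exists_tendsto_eLpNorm_avgKernel_sub [SecondCountableTopologyEither K Y]
    (μ : PartialProduct X K) {ψ : K × Y →ᵇ ℝ} {L : Filter (ℕ → X)} [L.IsCountablyGenerated]
    {x₀ : ℕ → X} (hL : L ≤ 𝓝 x₀) {v : (ℕ → X) × K → ℝ} (hv : MemLp v 1 (μ.μs.prod μ.μc))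
    (hlim : Tendsto (fun x => eLpNorm (fibreIntegral κ ψ x - v) 1 (μ.μs.prod μ.μc)) L (𝓝 0)) :
    ∃ w, MemLp w 1 μ.μc ∧ Tendsto
      (fun x => eLpNorm ((fun t => ∫ V, ψ (t, V) ∂(μ.avgKernel κ (x, t))) - w) 1 μ.μc)
      L (𝓝 0) := by
  obtain ⟨c, hc⟩ := μ.exists_norm_pastDensity_le
  have hmeas : ∀ x, AEStronglyMeasurable (μ.pastDensity x) (μ.μs.prod μ.μc) := fun x =>
    (μ.continuous_pastDensity.comp (by fun_prop : Continuous
      fun p : (ℕ → X) × K => (x, p))).aestronglyMeasurable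
  have hint : ∀ {u : (ℕ → X) × K → ℝ} (x : ℕ → X), MemLp u 1 (μ.μs.prod μ.μc) →
      Integrable (μ.pastDensity x • u) (μ.μs.prod μ.μc) := fun x hu =>
    (memLp_one_iff_integrable.1 hu).bdd_mul (hmeas x) (ae_of_all _ (hc x))
  have hG : ∀ x, MemLp (fibreIntegral κ ψ x) 1 (μ.μs.prod μ.μc) := fun x =>
    memLp_fibreIntegral μ ψ x 1
  have hlim' : Tendsto (fun x => eLpNorm (μ.pastDensity x • fibreIntegral κ ψ x -
      μ.pastDensity x₀ • v) 1 (μ.μs.prod μ.μc)) L (𝓝 0) :=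
    tendsto_eLpNorm_one_smul_sub_smul hmeas (hmeas x₀) hc
      (fun p => ((μ.continuous_pastDensity.comp (by fun_prop : Continuous
        fun x : ℕ → X => (x, p))).tendsto x₀).mono_left hL) (fun x => (hG x).1) hv hlim
  refine ⟨fun t => ∫ xs, (μ.pastDensity x₀ • v) (xs, t) ∂μ.μs,
    memLp_one_iff_integrable.2 (hint x₀ hv).integral_prod_right, ?_⟩
  simp only [integral_avgKernel_eq_integral_fibreIntegral]
  exact tendsto_of_tendsto_of_tendsto_of_le_of_le tendsto_const_nhds hlim' (fun _ => zero_le)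
    fun x => eLpNorm_one_integral_left_sub_le (hint x (hG x)) (hint x₀ hv)

end

variable {X : Set ℕ} {n : ℕ} {K : Type*} [MetricSpace K]
  [ChartedSpace (EuclideanSpace ℝ (Fin n)) K]
  [RiemannianBundle (fun t : K => TangentSpace (𝓡 n) t)]
  [MeasurableSpace K] [BorelSpace K] {F : SkewProduct X n K} {μ : PartialProduct X K}

theorem tendsto_eLpNorm_integral_oneSidedIter_sub
    (hμ : MeasurePreserving F.map μ.measure μ.measure)
    {f : (ℕ → X) → K → K} (hf : ∀ x t, F.fib x t = f (future x) t) {Y : Type*}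
    [TopologicalSpace Y] [CompactSpace Y] [MeasurableSpace Y] [OpensMeasurableSpace Y]
    {m : Kernel ((ℕ → X) × K) Y} [IsMarkovKernel m] (φ : C(Y, ℝ)) {x : ℕ → ℕ → X} {x₀ : ℕ → X}
    (hm : Tendsto (fun k => eLpNorm ((fun t => ∫ V, φ V ∂(m (x k, t))) -
      fun t => ∫ V, φ V ∂(m (x₀, t))) 1 μ.μc) atTop (𝓝 0)) {j : ℕ → ℕ} {g : K → K}
    (hg : TendstoUniformly (fun k => oneSidedIter f (x k) (j k)) g atTop) :
    (∀ k, MemLp (fun t => ∫ V, φ V ∂(m (x k, oneSidedIter f (x k) (j k) t))) 1 μ.μc) ∧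
      MemLp (fun t => ∫ V, φ V ∂(m (x₀, g t))) 1 μ.μc ∧
      Tendsto (fun k => eLpNorm (fun t => ∫ V, φ V ∂(m (x k, oneSidedIter f (x k) (j k) t)) -
        ∫ V, φ V ∂(m (x₀, g t))) 1 μ.μc) atTop (𝓝 0) := by
  obtain ⟨C, hC⟩ := μ.exists_map_fwd_le hμ
  have hfwd : ∀ y i, oneSidedIter f y i = F.fwd (glue y y) i := fun y i => funext fun t => by
    rw [← F.oneSidedIter_eq_fwd hf (glue y y) i t, future_glue]
  have hcont : ∀ k, Continuous (oneSidedIter f (x k) (j k)) := fun k => by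
    rw [hfwd]
    exact (F.fwd _ _).continuous
  have hgcont : Continuous g := hg.continuous (Frequently.of_forall hcont)
  have hint : ∀ (y : ℕ → X) {p : K → K}, Continuous p →
      MemLp (fun t => ∫ V, φ V ∂(m (y, p t))) 1 μ.μc := fun y p hp =>
    memLp_integral_continuousMap φ (measurable_const.prodMk hp.measurable) 1
  have hmap : ∀ k, μ.μc.map (oneSidedIter f (x k) (j k)) ≤ C • μ.μc := fun k => by
    rw [hfwd]
    exact (hC _ _).1
  refine ⟨fun k => hint _ (hcont k), hint _ hgcont, ?_⟩
  exact tendsto_eLpNorm_one_comp_sub_comp (u := fun k t => ∫ V, φ V ∂(m (x k, t)))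
    (w := fun t => ∫ V, φ V ∂(m (x₀, t))) (fun k => (hint (x k) continuous_id).1)
    (hint x₀ continuous_id) hm (fun k => (hcont k).measurable) hmap fun t => hg.tendsto_at t

variable [CompactSpace K] [IsRiemannianManifold (𝓡 n) K] {l d : ℕ} {α : ℝ}
  {H : (ℤ → X) × K → (ℤ → X) × K → (EuclideanSpace ℂ (Fin d) ≃L[ℂ] EuclideanSpace ℂ (Fin d))}
  {κ : Kernel ((ℤ → X) × K) (Grass l d)} [IsMarkovKernel κ] {S : Set ((ℤ → X) × K)}

theorem exists_modification_avgKernel (hF : F.MostlyNeutral)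
    (hμ : MeasurePreserving F.map μ.measure μ.measure) (hα : 0 < α)
    (hH : F.IsHolderHolonomy α H) (hS₀ : μ.measure Sᶜ = 0)
    (hS : ∀ b ∈ S, ∀ q ∈ S, F.Wuu b q → κ q = (κ b).map (Grass.map (H b q))) :
    ∃ m : Kernel ((ℕ → X) × K) (Grass l d), IsMarkovKernel m ∧
      (∀ x ∈ μ.fullFutures S, ∀ᵐ t ∂μ.μc, m (x, t) = μ.avgKernel κ (x, t)) ∧
      ∀ (φ : C(Grass l d, ℝ)) (x₀ : ℕ → X), Tendsto
        (fun x => eLpNorm ((fun t => ∫ V, φ V ∂(m (x, t))) - fun t => ∫ V, φ V ∂(m (x₀, t)))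
          1 μ.μc) (𝓝 x₀) (𝓝 0) := by
  have hdense := μ.dense_fullFutures hS₀
  have : Nonempty (Grass l d) := by
    obtain ⟨p⟩ := nonempty_of_isProbabilityMeasure μ.measure
    exact nonempty_of_isProbabilityMeasure (κ p)
  refine exists_modification_tendsto_eLpNorm (μ.avgKernel κ) hdense fun ψ x₀ => ?_
  obtain ⟨v, hv, hlim⟩ := exists_tendsto_eLpNorm_fibreIntegral_sub hF hμ hα hH hS hdense ψ x₀
  exact μ.exists_tendsto_eLpNorm_avgKernel_sub nhdsWithin_le_nhds hv hlim

end PartialProduct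

theorem exists_strictMono_ae_forall_tendsto_integral {Z K Y : Type*} [MeasurableSpace Z]
    [MeasurableSpace K] {ν : Measure K} [IsFiniteMeasure ν] [TopologicalSpace Y] [CompactSpace Y]
    [TopologicalSpace.MetrizableSpace Y] [MeasurableSpace Y] [OpensMeasurableSpace Y]
    {m : Kernel (Z × K) Y} [IsMarkovKernel m] {x : ℕ → Z} {x₀ : Z}
    (hm : ∀ φ : C(Y, ℝ), Tendsto (fun k => eLpNorm ((fun t => ∫ V, φ V ∂(m (x k, t))) -
      fun t => ∫ V, φ V ∂(m (x₀, t))) 1 ν) atTop (𝓝 0)) :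
    ∃ i : ℕ → ℕ, StrictMono i ∧ ∀ᵐ t ∂ν, ∀ φ : C(Y, ℝ),
      Tendsto (fun k => ∫ V, φ V ∂(m (x (i k), t))) atTop (𝓝 (∫ V, φ V ∂(m (x₀, t)))) := by
  let φ := TopologicalSpace.denseSeq C(Y, ℝ)
  have hmeas : ∀ (a : ℕ) (y : Z), AEStronglyMeasurable (fun t => ∫ V, φ a V ∂(m (y, t))) ν :=
    fun a y => (memLp_integral_continuousMap (φ a) measurable_prodMk_left 1).1
  obtain ⟨i, hi, hlim⟩ := exists_strictMono_forall_ae_tendsto (fun a k => hmeas a (x k))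
    (fun a => hmeas a x₀) fun a => hm (φ a)
  refine ⟨i, hi, hlim.mono fun t ht => tendsto_integral_of_dense
    (TopologicalSpace.denseRange_denseSeq C(Y, ℝ)) ?_⟩
  rintro _ ⟨a, rfl⟩
  exact ht a

end OneSidedDisintegration

end UStates

theorem propositionp_general {X : Set ℕ} {n : ℕ} {K : Type*}
    [MetricSpace K] [CompactSpace K] [MeasurableSpace K] [BorelSpace K]
    [ChartedSpace (EuclideanSpace ℝ (Fin n)) K]
    [RiemannianBundle (fun t : K => TangentSpace (𝓡 n) t)] [IsRiemannianManifold (𝓡 n) K]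
    (F : UStates.SkewProduct X n K) (hF : F.MostlyNeutral)
    (μ : UStates.PartialProduct X K) (hμ : MeasurePreserving F.map μ.measure μ.measure)
    {l d : ℕ} {α : ℝ} (hα : 0 < α)
    (H : (ℤ → X) × K → (ℤ → X) × K →
      (EuclideanSpace ℂ (Fin d) ≃L[ℂ] EuclideanSpace ℂ (Fin d)))
    (hH : F.IsHolderHolonomy α H)
    (f : (ℕ → X) → K → K) (hf : ∀ x t, F.fib x t = f (UStates.future x) t)
    (mhat : Measure (((ℤ → X) × K) × UStates.Grass l d))
    (κ : Kernel ((ℤ → X) × K) (UStates.Grass l d)) (S : Set ((ℤ → X) × K))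
    (hm : UStates.IsUState F H μ.measure mhat κ S) :
    ∃ m : Kernel ((ℕ → X) × K) (UStates.Grass l d),
      IsMarkovKernel m ∧
      (μ.measure.map (fun p => (UStates.future p.1, p.2))) ⊗ₘ m =
        mhat.map (fun z => ((UStates.future z.1.1, z.1.2), z.2)) ∧
      (∀ x : ℕ → X, (∀ᵐ p ∂(μ.μs.prod μ.μc), (UStates.glue p.1 x, p.2) ∈ S) →
        ∀ᵐ t ∂μ.μc, m (x, t) =
          (ENNReal.ofReal (μ.ρu x t))⁻¹ •
            (μ.μs.withDensity (fun xs => ENNReal.ofReal (μ.ρ (UStates.glue xs x, t)))).bind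
              (fun xs => κ (UStates.glue xs x, t))) ∧
      (∀ (φ : UStates.Grass l d → ℝ), Continuous φ →
        ∀ (x : ℕ → ℕ → X) (x₀ : ℕ → X), Tendsto x atTop (𝓝 x₀) →
        ∀ (j : ℕ → ℕ) (g : K → K),
          TendstoUniformly (fun k => UStates.oneSidedIter f (x k) (j k)) g atTop →
          (∀ k, MemLp (fun t => ∫ V, φ V ∂(m (x k, UStates.oneSidedIter f (x k) (j k) t)))
            1 μ.μc) ∧
          MemLp (fun t => ∫ V, φ V ∂(m (x₀, g t))) 1 μ.μc ∧
          Tendsto (fun k => eLpNorm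
            (fun t => ∫ V, φ V ∂(m (x k, UStates.oneSidedIter f (x k) (j k) t)) -
              ∫ V, φ V ∂(m (x₀, g t))) 1 μ.μc) atTop (𝓝 0)) ∧
      (∀ (x : ℕ → ℕ → X) (x₀ : ℕ → X), Tendsto x atTop (𝓝 x₀) →
        ∃ i : ℕ → ℕ, StrictMono i ∧ ∀ᵐ t ∂μ.μc,
          ∀ φ : UStates.Grass l d → ℝ, Continuous φ →
            Tendsto (fun k => ∫ V, φ V ∂(m (x (i k), t))) atTop
              (𝓝 (∫ V, φ V ∂(m (x₀, t))))) := by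
  have := hm.markov
  obtain ⟨m, hm_markov, hm_avg, hm_cont⟩ :=
    UStates.PartialProduct.exists_modification_avgKernel hF hμ hα hH hm.full hm.invariant
  refine ⟨m, hm_markov, ?disintegration, hm_avg, ?continuity, ?subsequence⟩
  case disintegration =>
    rw [← hm.disintegration]
    exact μ.oneSided_compProd_of_ae_eq_avgKernel
      ((μ.ae_mem_fullFutures hm.full).mono fun x hx => hm_avg x hx)
  case continuity =>
    intro φ hφ x x₀ hx j g hg
    exact UStates.PartialProduct.tendsto_eLpNorm_integral_oneSidedIter_sub hμ hf ⟨φ, hφ⟩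
      ((hm_cont ⟨φ, hφ⟩ x₀).comp hx) hg
  case subsequence =>
    intro x x₀ hx
    obtain ⟨i, hi, hlim⟩ := UStates.exists_strictMono_ae_forall_tendsto_integral
      fun φ => (hm_cont φ x₀).comp hx
    exact ⟨i, hi, hlim.mono fun t ht φ hφ => ht ⟨φ, hφ⟩⟩

theorem propositionp {X : Set ℕ} (hX : X.Nontrivial) {n : ℕ} {K : Type*}
    [MetricSpace K] [CompactSpace K] [MeasurableSpace K] [BorelSpace K]
    [ChartedSpace (EuclideanSpace ℝ (Fin n)) K] [IsManifold (𝓡 n) ∞ K]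
    [RiemannianBundle (fun t : K => TangentSpace (𝓡 n) t)]
    [IsContMDiffRiemannianBundle (𝓡 n) ∞ (EuclideanSpace ℝ (Fin n))
      (fun t : K => TangentSpace (𝓡 n) t)]
    [IsRiemannianManifold (𝓡 n) K]
    -- the skew-product and its invariant measure
    (F : UStates.SkewProduct X n K) (hF : F.MostlyNeutral)
    (μ : UStates.PartialProduct X K) (hμ : MeasurePreserving F.map μ.measure μ.measure)
    -- the linear cocycle and its strong-unstable holonomies
    {l d : ℕ} (hl : 1 ≤ l) (hld : l < d) {α : ℝ} (hα : 0 < α)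
    (A : (ℤ → X) × K → (EuclideanSpace ℂ (Fin d) ≃L[ℂ] EuclideanSpace ℂ (Fin d)))
    (hA : UStates.IsHolderCocycle α A)
    (H : (ℤ → X) × K → (ℤ → X) × K →
      (EuclideanSpace ℂ (Fin d) ≃L[ℂ] EuclideanSpace ℂ (Fin d)))
    (hH : UStates.IsUnstableHolonomy F α A H)
    -- the fibre maps and the cocycle depend on the future only
    (f : (ℕ → X) → K → K) (hf : ∀ x t, F.fib x t = f (UStates.future x) t)
    (hAf : ∀ x y t, UStates.future x = UStates.future y → A (x, t) = A (y, t))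
    -- an invariant `u`-state
    (mhat : Measure (((ℤ → X) × K) × UStates.Grass l d))
    (hinv : MeasurePreserving (UStates.grassMap F A) mhat mhat)
    (κ : Kernel ((ℤ → X) × K) (UStates.Grass l d)) (S : Set ((ℤ → X) × K))
    (hm : UStates.IsUState F H μ.measure mhat κ S) :
    ∃ m : Kernel ((ℕ → X) × K) (UStates.Grass l d),
      -- `m` is a disintegration of the projection of `mhat`
      IsMarkovKernel m ∧
      (μ.measure.map (fun p => (UStates.future p.1, p.2))) ⊗ₘ m =
        mhat.map (fun z => ((UStates.future z.1.1, z.1.2), z.2)) ∧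
      -- it is the average of `κ` along the pasts, for each future with `S` of full measure above it
      (∀ x : ℕ → X, (∀ᵐ p ∂(μ.μs.prod μ.μc), (UStates.glue p.1 x, p.2) ∈ S) →
        ∀ᵐ t ∂μ.μc, m (x, t) =
          (ENNReal.ofReal (μ.ρu x t))⁻¹ •
            (μ.μs.withDensity (fun xs => ENNReal.ofReal (μ.ρ (UStates.glue xs x, t)))).bind
              (fun xs => κ (UStates.glue xs x, t))) ∧
      -- `L¹` continuity
      (∀ (φ : UStates.Grass l d → ℝ), Continuous φ →
        ∀ (x : ℕ → ℕ → X) (x₀ : ℕ → X), Tendsto x atTop (𝓝 x₀) →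
        ∀ (j : ℕ → ℕ) (g : K → K),
          TendstoUniformly (fun k => UStates.oneSidedIter f (x k) (j k)) g atTop →
          (∀ k, MemLp (fun t => ∫ V, φ V ∂(m (x k, UStates.oneSidedIter f (x k) (j k) t)))
            1 μ.μc) ∧
          MemLp (fun t => ∫ V, φ V ∂(m (x₀, g t))) 1 μ.μc ∧
          Tendsto (fun k => eLpNorm
            (fun t => ∫ V, φ V ∂(m (x k, UStates.oneSidedIter f (x k) (j k) t)) -
              ∫ V, φ V ∂(m (x₀, g t))) 1 μ.μc) atTop (𝓝 0)) ∧
      -- almost everywhere weak* convergence along a subsequence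
      (∀ (x : ℕ → ℕ → X) (x₀ : ℕ → X), Tendsto x atTop (𝓝 x₀) →
        ∃ i : ℕ → ℕ, StrictMono i ∧ ∀ᵐ t ∂μ.μc,
          ∀ φ : UStates.Grass l d → ℝ, Continuous φ →
            Tendsto (fun k => ∫ V, φ V ∂(m (x (i k), t))) atTop
              (𝓝 (∫ V, φ V ∂(m (x₀, t))))) :=
  propositionp_general F hF μ hμ hα H hH.holder f hf mhat κ S hm
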